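/- Let $k$ be a field. A commutative Hopf algebroid $\mathcal U=(U,A,s,t,\Delta,\epsilon,S)$ over $k$ consists of commutative unital $k$-algebras $U$ and $A$, unital $k$-algebra morphisms $s,t:A\to U$, and, for the $(A,A)$-bimodule structure $a\cdot u\cdot b=s(a)t(b)u$ on $U$, a coalgebra $(U,\Delta:U\to U\otimes_A U,\epsilon:U\to A)$ in $(A,A)$-bimodules such that $\Delta$ is a morphism of unital $k$-algebras and $\epsilon(us(\epsilon(u')))=\epsilon(uu')=\epsilon(ut(\epsilon(u')))$, together with an involutive $k$-algebra automorphism $S$ of $U$ with $S\circ t=s$ and, in $U\otimes_A U$, $$S(u_{(1)})_{(1)}u_{(2)}\otimes S(u_{(1)})_{(2)}=1\otimes S(u),\qquad S(u_{(2)})_{(1)}\otimes S(u_{(2)})_{(2)}u_{(1)}=S(u)\otimes 1 .$$ For a $k$-coalgebra $C$ and $k$-algebras $R,R'$, a measuring of algebras from $R$ to $R'$ is a $k$-linear map $\psi:C\to \mathrm{Hom}_k(R,R')$ with $\psi(x)(ab)=\sum\psi(x_{(1)})(a)\,\psi(x_{(2)})(b)$ and $\psi(x)(1)=\epsilon_C(x)1$;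 write $x(a)=\psi(x)(a)$. A measuring $(\Psi,\psi)$ of commutative Hopf algebroids from $\mathcal U$ to $\mathcal U'$ by a cocommutative coalgebra $C$ is a pair of measurings of algebras $\Psi:C\to\mathrm{Hom}_k(U,U')$ and $\psi:C\to\mathrm{Hom}_k(A,A')$ such that every $x\in C$ commutes with the sources, targets, antipodes, counits and coproducts, where $x(u^1\otimes u^2)=\sum x_{(1)}(u^1)\otimes x_{(2)}(u^2)$ on $U\otimes_A U$. Regard $U$ as an $A$-algebra through $t$, put $\epsilon_R=\epsilon\circ S$, and let $C_n(\mathcal U)=U\otimes_A\cdots\otimes_A U$ ($n$ factors), $C_0(\mathcal U)=A$, with differential $\sum_{i=0}^n(-1)^id_i:C_n(\mathcal U)\to C_{n-1}(\mathcal U)$, where $$d_0(u^1\otimes\cdots\otimes u^n)=\epsilon_R(u^1)\cdot u^2\otimes\cdots\otimes u^n,\qquad d_n(u^1\otimes\cdots\otimes u^n)=u^1\otimes\cdots\otimes u^{n-1}\cdot\epsilon_R(S(u^n)),$$ and $d_i(u^1\otimes\cdots\otimes u^n)=u^1\otimes\cdots\otimes u^iu^{i+1}\otimes\cdots\otimes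 u^n$ for $1\le i\le n-1$ (for $n=1$, $d_0(u)=\epsilon_R(u)$ and $d_1(u)=\epsilon_R(S(u))$). Its homology is the Hochschild homology $HH_\bullet(\mathcal U)=\bigoplus_{n\ge0}HH_n(\mathcal U)$. It is a graded $k$-algebra, with unit the class of $1_A$, under the product induced by the shuffle products $C_p(\mathcal U)\otimes C_q(\mathcal U)\to C_{p+q}(\mathcal U)$, $$(u^1\otimes\cdots\otimes u^p)\otimes(u^{p+1}\otimes\cdots\otimes u^{p+q})\mapsto\sum_{\sigma}\mathrm{sgn}(\sigma)\,u^{\sigma^{-1}(1)}\otimes\cdots\otimes u^{\sigma^{-1}(p+q)},$$ where $\sigma$ runs over the permutations of $\{1,\dots,p+q\}$ with $\sigma(1)<\cdots<\sigma(p)$ and $\sigma(p+1)<\cdots<\sigma(p+q)$; if $p=0$ or $q=0$ the product is the $A$-module action (for $p=q=0$, the multiplication of $A$). **Proposition.** Let $\mathcal U,\mathcal U'$ be commutative Hopf algebroids over $k$, let $C$ be a cocommutative $k$-coalgebra and let $(\Psi,\psi)$ be a measuring of Hopf algebroids from $\mathcal U$ to $\mathcal U'$ by $C$. For $x\in C$,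 let $\underline\Psi^{hoc}_\bullet(x):HH_\bullet(\mathcal U)\to HH_\bullet(\mathcal U')$ be the map induced by the morphism of complexes $$\underline\Psi_n(x)(u^1\otimes\cdots\otimes u^n)=\sum x_{(1)}(u^1)\otimes\cdots\otimes x_{(n)}(u^n)\quad(n\ge1),\qquad \underline\Psi_0(x)=\psi(x).$$ Then the $k$-linear map $\underline\Psi^{hoc}:C\to\mathrm{Hom}_k(HH_\bullet(\mathcal U),HH_\bullet(\mathcal U'))$, $x\mapsto\underline\Psi^{hoc}_\bullet(x)$, is a measuring of algebras from $HH_\bullet(\mathcal U)$ to $HH_\bullet(\mathcal U')$, both with their shuffle products. -/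

import Mathlib

open scoped TensorProduct DirectSum

namespace HopfMeasuring

set_option linter.unusedSimpArgs false
section ShuffleAlg
variable {A V M : Type*} [CommRing A] [AddCommGroup M] [Module A M]

/-- Auxiliary: the recursive rules satisfied by signed shuffles, for the words `W l`, the operation
`L u` of putting the letter `u` in front, the sign operator `J` and the product `sh`. They are
proved below for the tensor algebra and its signed shuffle product. -/
structure ShuffleRules (W : List V → M) (L : V → M →ₗ[A] M) (J : M →ₗ[A] M)
    (sh : M →ₗ[A] M →ₗ[A] M) : Prop where
  word_cons : ∀ u l, W (u :: l) = L u (W l)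
  J_word : ∀ l, J (W l) = (-1 : A) ^ l.length • W l
  J_L : ∀ u x, J (L u x) = - L u (J x)
  nil_sh : ∀ x, sh (W []) x = x
  sh_nil : ∀ x, sh x (W []) = x
  sh_LL : ∀ u v x y, sh (L u x) (L v y) = L u (sh x (L v y)) + L v (sh (J (L u x)) y)

variable {W : List V → M} {L : V → M →ₗ[A] M} {J : M →ₗ[A] M} {sh : M →ₗ[A] M →ₗ[A] M}

lemma ShuffleRules.J_cons (h : ShuffleRules W L J sh) (u : V) (a : List V) :
    J (L u (W a)) = (-(-1 : A) ^ a.length) • L u (W a) := by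
  rw [h.J_L, h.J_word, map_smul, neg_smul]

lemma ShuffleRules.J_sh (h : ShuffleRules W L J sh) : ∀ a b, J (sh (W a) (W b)) =
    ((-1 : A) ^ a.length * (-1 : A) ^ b.length) • sh (W a) (W b) := by
  intro a
  induction a with
  | nil => intro b; simp [h.nil_sh, h.J_word]
  | cons u a iha =>
    intro b
    induction b with
    | nil => simp [h.sh_nil, h.J_word]
    | cons v b ihb =>
      have i1 := iha (v :: b)
      simp only [h.word_cons, List.length_cons, pow_succ] at i1 ihb ⊢
      rw [h.sh_LL, map_add, h.J_L, h.J_L, h.J_cons, i1]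
      simp only [map_smul, LinearMap.smul_apply]
      rw [ihb]
      simp only [map_smul]
      module

lemma ShuffleRules.assoc (h : ShuffleRules W L J sh) : ∀ a b c,
    sh (sh (W a) (W b)) (W c) = sh (W a) (sh (W b) (W c)) := by
  intro a
  induction a with
  | nil => intro b c; simp [h.nil_sh]
  | cons u a iha =>
    intro b
    induction b with
    | nil => intro c; simp [h.nil_sh, h.sh_nil]
    | cons v b ihb =>
      intro c
      induction c with
      | nil => simp [h.sh_nil]
      | cons w c ihc =>
        have i1 := iha (v :: b) (w :: c)
        have i2 := ihb (w :: c)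
        have eP := h.J_sh a (v :: b)
        have eQ := h.J_sh (u :: a) b
        have r := h.sh_LL u v (W a) (W b)
        have r' := h.sh_LL v w (W b) (W c)
        have r1 := h.sh_LL u v (W a) (sh (W b) (W (w :: c)))
        have r2 := h.sh_LL u w (W a) (sh (W (v :: b)) (W c))
        have r3 := h.sh_LL u w (sh (W a) (W (v :: b))) (W c)
        have r4 := h.sh_LL v w (sh (W (u :: a)) (W b)) (W c)
        simp only [h.word_cons, List.length_cons, pow_succ, h.J_cons, map_smul,
          LinearMap.smul_apply] at i1 i2 ihc eP eQ r r' r1 r2 r3 r4 ⊢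
        generalize (-1 : A) ^ a.length = s at *
        generalize (-1 : A) ^ b.length = t at *
        rw [h.J_L, eP] at r3
        rw [h.J_L, eQ] at r4
        rw [r] at ihc ⊢
        rw [r'] at i1 ⊢
        simp only [map_add, LinearMap.add_apply, map_smul, LinearMap.smul_apply, map_neg,
          LinearMap.neg_apply] at i1 ihc r1 r2 r3 r4 ⊢
        rw [r1, r2, r3, r4, i1, i2, ← ihc]
        simp only [map_add, map_smul]
        module


lemma ShuffleRules.leibniz_first (h : ShuffleRules W L J sh) (φ : M →ₗ[A] M) (α : V → A)
    (h0 : φ (W []) = 0) (hL : ∀ u x, φ (L u x) = α u • x) :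
    ∀ a b, φ (sh (W a) (W b)) = sh (φ (W a)) (W b) + sh (J (W a)) (φ (W b)) := by
  intro a b
  cases a with
  | nil => simp [h.nil_sh, h0, h.J_word]
  | cons u a =>
    cases b with
    | nil => simp [h.sh_nil, h0]
    | cons v b => simp only [h.word_cons, h.sh_LL, map_add, hL, map_smul, LinearMap.smul_apply]

lemma leibniz_tail {V : Type*} [CommRing V] {W : List V → M} {L : V → M →ₗ[A] M}
    (h : ShuffleRules W L J sh) (φ : M →ₗ[A] M) (β : V → A)
    (h0 : φ (W []) = 0) (hJ : ∀ x, J (φ x) = - φ (J x)) (N : V → M →ₗ[A] M)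
    (hL : ∀ u x, φ (L u x) = - N u x - L u (φ x))
    (hN0 : ∀ u, N u (W []) = β u • W []) (hN : ∀ u v x, N u (L v x) = L (u * v) x) :
    ∀ a b, φ (sh (W a) (W b)) = sh (φ (W a)) (W b) + sh (J (W a)) (φ (W b)) := by
  intro a
  induction a with
  | nil => intro b; simp [h.nil_sh, h0, h.J_word]
  | cons u a iha =>
    intro b
    induction b with
    | nil => simp [h.sh_nil, h0]
    | cons v b ihb =>
      have i1 := iha (v :: b)
      have key : sh (N u (W a)) (L v (W b)) + sh (J (L u (W a))) (N v (W b)) =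
          N u (sh (W a) (L v (W b))) - L u (sh (J (W a)) (N v (W b)))
          + N v (sh (J (L u (W a))) (W b)) + L v (sh (N u (J (W a))) (W b)) := by
        rcases a with _ | ⟨p, a⟩ <;> rcases b with _ | ⟨q, b⟩ <;>
        simp only [h.word_cons, h.nil_sh, h.sh_nil, h.J_L, hN, hN0, h.J_word, map_smul, map_neg,
          LinearMap.smul_apply, LinearMap.neg_apply, h.sh_LL, map_add, map_sub, List.length_nil,
          List.length_cons, pow_zero, one_smul, mul_comm v]
        · module
        · module
        · module
        · module
      have e1 := h.sh_LL u v (φ (W a)) (W b)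
      have e2 := h.sh_LL u v (W a) (φ (W b))
      simp only [h.word_cons, hJ, h.J_L u (φ (W a)), h.J_cons, h.J_word, map_neg, map_smul,
        LinearMap.neg_apply, LinearMap.smul_apply, neg_neg, hL, map_sub,
        LinearMap.sub_apply] at i1 ihb key e1 e2 ⊢
      rw [h.sh_LL, h.J_cons]
      generalize (-1 : A) ^ a.length = s at *
      simp only [map_add, hL, map_smul, LinearMap.smul_apply]
      rw [i1, ihb, e1, e2]
      simp only [map_add, map_sub, map_neg, map_smul]
      linear_combination (norm := module) key

end ShuffleAlg

/- The bar complex of an augmented commutative algebra `V` over a commutative ring `A`, with its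
shuffle product. -/
section Bar

variable (A V : Type*) [CommRing A] [CommRing V] [Algebra A V]

/-- The `n`-fold tensor product `V ⊗_A ⋯ ⊗_A V`; it is (a free module of rank one over) `A` for
`n = 0`. -/
abbrev TPow (n : ℕ) : Type _ := ⨂[A]^n V

variable {A V}

lemma contractNth_update {n : ℕ} (j : Fin n) (m : Fin (n + 1) → V) (i : Fin (n + 1)) :
    ∃ (i' : Fin n) (c : V →ₗ[A] V), ∀ x : V,
      j.castSucc.contractNth (· * ·) (Function.update m i x) =
        Function.update (j.castSucc.contractNth (· * ·) m) i' (c x) := by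
  rcases lt_trichotomy (i : ℕ) (j : ℕ) with h | h | h
  · refine ⟨⟨i, by omega⟩, LinearMap.id, fun x => funext fun l => ?_⟩
    simp only [Fin.contractNth, Function.update_apply, Fin.ext_iff, Fin.val_castSucc, Fin.val_succ,
      LinearMap.id_apply]
    split_ifs <;> first | rfl | omega
  · refine ⟨⟨i, by omega⟩, LinearMap.mulRight A (m j.succ), fun x => funext fun l => ?_⟩
    simp only [Fin.contractNth, Function.update_apply, Fin.ext_iff, Fin.val_castSucc, Fin.val_succ,
      LinearMap.mulRight_apply]
    split_ifs <;> first | rfl | omega | skip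
    have : l = j := by ext; omega
    rw [this]
  · by_cases h' : (i : ℕ) = j + 1
    · refine ⟨j, LinearMap.mulLeft A (m j.castSucc), fun x => funext fun l => ?_⟩
      simp only [Fin.contractNth, Function.update_apply, Fin.ext_iff, Fin.val_castSucc,
        Fin.val_succ, LinearMap.mulLeft_apply]
      split_ifs <;> first | rfl | omega | skip
      have : l = j := by ext; omega
      rw [this]
    · refine ⟨⟨i - 1, by omega⟩, LinearMap.id, fun x => funext fun l => ?_⟩
      simp only [Fin.contractNth, Function.update_apply, Fin.ext_iff, Fin.val_castSucc,
        Fin.val_succ, LinearMap.id_apply]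
      split_ifs <;> first | rfl | omega

lemma dec_eq {n : ℕ} (inst : DecidableEq (Fin n)) : inst = instDecidableEqFin n :=
  Subsingleton.elim _ _

/-- The inner faces: `u¹ ⊗ ⋯ ⊗ uⁿ⁺¹ ↦ u¹ ⊗ ⋯ ⊗ u^i u^{i+1} ⊗ ⋯ ⊗ uⁿ⁺¹`, with `i = j + 1`. -/
noncomputable def faceMid {n : ℕ} (j : Fin n) : TPow A V (n + 1) →ₗ[A] TPow A V n :=
  PiTensorProduct.lift
    { toFun := fun u => PiTensorProduct.tprod A (j.castSucc.contractNth (· * ·) u)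
      map_update_add' := by
        intro inst m i x y
        obtain rfl := dec_eq inst
        obtain ⟨i', c, hc⟩ := contractNth_update (A := A) j m i
        simp only [hc, map_add, MultilinearMap.map_update_add]
      map_update_smul' := by
        intro inst m i r x
        obtain rfl := dec_eq inst
        obtain ⟨i', c, hc⟩ := contractNth_update (A := A) j m i
        simp only [hc, map_smul, MultilinearMap.map_update_smul] }

/-- The first face: `u¹ ⊗ ⋯ ⊗ uⁿ⁺¹ ↦ α(u¹) · u² ⊗ ⋯ ⊗ uⁿ⁺¹`. -/
noncomputable def faceFirst (α : V →ₗ[A] A) (n : ℕ) : TPow A V (n + 1) →ₗ[A] TPow A V n :=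
  PiTensorProduct.lift
    { toFun := fun u => α (u 0) • PiTensorProduct.tprod A (Fin.tail u)
      map_update_add' := by
        intro inst m i x y
        obtain rfl := dec_eq inst
        refine Fin.cases ?_ (fun i => ?_) i
        · simp [Fin.tail_update_zero, add_smul]
        · simp [Fin.tail_update_succ, Function.update_of_ne (Fin.succ_ne_zero i).symm]
      map_update_smul' := by
        intro inst m i r x
        obtain rfl := dec_eq inst
        refine Fin.cases ?_ (fun i => ?_) i
        · simp [Fin.tail_update_zero, mul_smul]
        · simp [Fin.tail_update_succ, Function.update_of_ne (Fin.succ_ne_zero i).symm, smul_comm r] }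

/-- The last face: `u¹ ⊗ ⋯ ⊗ uⁿ⁺¹ ↦ u¹ ⊗ ⋯ ⊗ uⁿ · β(uⁿ⁺¹)`. -/
noncomputable def faceLast (β : V →ₗ[A] A) (n : ℕ) : TPow A V (n + 1) →ₗ[A] TPow A V n :=
  PiTensorProduct.lift
    { toFun := fun u => β (u (Fin.last n)) • PiTensorProduct.tprod A (Fin.init u)
      map_update_add' := by
        intro inst m i x y
        obtain rfl := dec_eq inst
        refine Fin.lastCases ?_ (fun i => ?_) i
        · simp [Fin.init_update_last, add_smul]
        · simp [Fin.init_update_castSucc, (Fin.castSucc_lt_last _).ne']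
      map_update_smul' := by
        intro inst m i r x
        obtain rfl := dec_eq inst
        refine Fin.lastCases ?_ (fun i => ?_) i
        · simp [Fin.init_update_last, mul_smul]
        · simp [Fin.init_update_castSucc, smul_comm r, (Fin.castSucc_lt_last _).ne'] }

/-- `u ⊗ (u¹ ⊗ ⋯ ⊗ uⁿ) ↦ u ⊗ u¹ ⊗ ⋯ ⊗ uⁿ`. -/
noncomputable def consMap (n : ℕ) : V →ₗ[A] TPow A V n →ₗ[A] TPow A V (n + 1) :=
  (PiTensorProduct.lift (R := A) (s := fun _ : Fin n => V)
    (E := TPow A V (n + 1))).toLinearMap ∘ₗ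
    (PiTensorProduct.tprod A (s := fun _ : Fin (n + 1) => V)).curryLeft

lemma consMap_tprod {n : ℕ} (u : V) (f : Fin n → V) :
    consMap n u (PiTensorProduct.tprod A f) = PiTensorProduct.tprod A (Fin.cons u f : Fin (n+1) → V) := by
  simp [consMap]



/-- The alternating sum of all faces but the first. -/
noncomputable def dTail (β : V →ₗ[A] A) (n : ℕ) : TPow A V (n + 1) →ₗ[A] TPow A V n :=
  (∑ j : Fin n, (-1 : A) ^ ((j : ℕ) + 1) • faceMid j) + (-1 : A) ^ (n + 1) • faceLast β n

/-- The differential `∑ (-1)^i d_i : C_{n+1} → C_n`, where `C_n = V ⊗_A ⋯ ⊗_A V`, `d_0` is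
`faceFirst`, `d_{n+1}` is `faceLast` and the other `d_i` multiply adjacent factors. -/
noncomputable def bar_d (α β : V →ₗ[A] A) (n : ℕ) : TPow A V (n + 1) →ₗ[A] TPow A V n :=
  faceFirst α n + (∑ j : Fin n, (-1 : A) ^ ((j : ℕ) + 1) • faceMid j) + (-1 : A) ^ (n + 1) • faceLast β n

variable (A V) in
/-- The sum of all tensor powers. -/
abbrev Tot : Type _ := ⨁ n, TPow A V n

lemma tot_neg_smul (a : A) (x : Tot A V) : (-a) • x = -(a • x) := neg_smul a x

/-- The pure tensor whose factors are listed by `l`. -/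
noncomputable def word (l : List V) : Tot A V :=
  DirectSum.lof A ℕ (TPow A V) l.length (PiTensorProduct.tprod A l.get)

lemma lof_tprod {n : ℕ} (f : Fin n → V) :
    DirectSum.lof A ℕ (TPow A V) n (PiTensorProduct.tprod A f) = word (List.ofFn f) := by
  have key : ∀ (m : ℕ) (g : Fin m → V) (h : n = m), (g = f ∘ Fin.cast h.symm) →
      DirectSum.lof A ℕ (TPow A V) n (PiTensorProduct.tprod A f)
        = DirectSum.lof A ℕ (TPow A V) m (PiTensorProduct.tprod A g) := by
    rintro m g rfl hg
    rw [hg]; rfl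
  refine key _ _ (by simp) ?_
  funext i
  simp
  rfl

lemma word_cons_eq (u : V) (l : List V) :
    (word (u :: l) : Tot A V) = DirectSum.lof A ℕ (TPow A V) (l.length + 1)
      (PiTensorProduct.tprod A (Fin.cons u l.get : Fin (l.length + 1) → V)) := by
  rw [word]
  congr 2
  funext i
  refine Fin.cases rfl (fun _ => rfl) i

lemma tot_ext {X : Type*} [AddCommMonoid X] [Module A X] {f g : Tot A V →ₗ[A] X}
    (h : ∀ l, f (word l) = g (word l)) : f = g := by
  refine DirectSum.linearMap_ext A fun n => PiTensorProduct.ext ?_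
  ext u
  simpa [lof_tprod] using h (List.ofFn u)

variable (A) in
/-- Put the factor `u` in front. -/
noncomputable def L (u : V) : Tot A V →ₗ[A] Tot A V :=
  DirectSum.toModule A ℕ _ fun n => DirectSum.lof A ℕ (TPow A V) (n + 1) ∘ₗ consMap n u

variable (A V) in
/-- The sign `(-1)^n` in degree `n`. -/
noncomputable def J : Tot A V →ₗ[A] Tot A V :=
  DirectSum.toModule A ℕ _ fun n => (-1 : A) ^ n • DirectSum.lof A ℕ (TPow A V) n

/-- The total operator assembled from maps of degree `-1`. -/
noncomputable def down (φ : ∀ n, TPow A V (n + 1) →ₗ[A] TPow A V n) : Tot A V →ₗ[A] Tot A V :=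
  DirectSum.toModule A ℕ _ fun n => match n with
    | 0 => 0
    | n + 1 => DirectSum.lof A ℕ (TPow A V) n ∘ₗ φ n

lemma L_lof (u : V) {n : ℕ} (x : TPow A V n) :
    L A u (DirectSum.lof A ℕ (TPow A V) n x) =
      DirectSum.lof A ℕ (TPow A V) (n + 1) (consMap n u x) := by
  rw [L, DirectSum.toModule_lof, LinearMap.comp_apply]

lemma word_cons (u : V) (l : List V) : (word (u :: l) : Tot A V) = L A u (word l) := by
  rw [word_cons_eq, word, L_lof, consMap_tprod]

lemma J_lof {n : ℕ} (x : TPow A V n) :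
    J A V (DirectSum.lof A ℕ (TPow A V) n x) =
      (-1 : A) ^ n • DirectSum.lof A ℕ (TPow A V) n x := by
  rw [J, DirectSum.toModule_lof, LinearMap.smul_apply]

lemma J_word (l : List V) : J A V (word l) = (-1 : A) ^ l.length • word l := J_lof _

lemma J_L (u : V) (x : Tot A V) : J A V (L A u x) = - L A u (J A V x) := by
  have : J A V ∘ₗ L A u = -(L A u ∘ₗ J A V) := by
    refine tot_ext fun l => ?_
    simp only [LinearMap.comp_apply, LinearMap.neg_apply, ← word_cons, J_word, map_smul,
      List.length_cons, pow_succ, mul_neg, mul_one, tot_neg_smul]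
  exact LinearMap.congr_fun this x

lemma down_lof (φ : ∀ n, TPow A V (n + 1) →ₗ[A] TPow A V n) (n : ℕ) (x : TPow A V (n + 1)) :
    down φ (DirectSum.lof A ℕ (TPow A V) (n + 1) x) = DirectSum.lof A ℕ (TPow A V) n (φ n x) := by
  simp only [down]
  rw [DirectSum.toModule_lof]; rfl

lemma down_lof_zero (φ : ∀ n, TPow A V (n + 1) →ₗ[A] TPow A V n) (x : TPow A V 0) :
    down φ (DirectSum.lof A ℕ (TPow A V) 0 x) = 0 := by
  simp only [down]
  rw [DirectSum.toModule_lof]; rfl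

lemma down_word_nil (φ : ∀ n, TPow A V (n + 1) →ₗ[A] TPow A V n) :
    down φ (word []) = 0 := down_lof_zero _ _

lemma J_down (φ : ∀ n, TPow A V (n + 1) →ₗ[A] TPow A V n) (x : Tot A V) :
    J A V (down φ x) = - down φ (J A V x) := by
  have : J A V ∘ₗ down φ = -(down φ ∘ₗ J A V) := by
    refine DirectSum.linearMap_ext A fun n => LinearMap.ext fun x => ?_
    cases n with
    | zero =>
      simp only [LinearMap.comp_apply, LinearMap.neg_apply, down_lof_zero, J_lof,
        map_smul, map_zero, smul_zero, neg_zero]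
    | succ n =>
      simp only [LinearMap.comp_apply, LinearMap.neg_apply, down_lof, J_lof, map_smul]
      rw [pow_succ, mul_neg, mul_one, tot_neg_smul, neg_neg]
  exact LinearMap.congr_fun this x

lemma faceFirst_word (α : V →ₗ[A] A) (u : V) (l : List V) :
    down (faceFirst α) (word (u :: l)) = α u • word l := by
  rw [word_cons_eq, down_lof, faceFirst, PiTensorProduct.lift.tprod]
  simp only [MultilinearMap.coe_mk, map_smul, word]
  rfl

lemma dTail_word_one (β : V →ₗ[A] A) (u : V) :
    down (dTail β) (word [u]) = -(β u • word []) := by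
  rw [word_cons_eq, down_lof]
  have : dTail β ([] : List V).length
      (PiTensorProduct.tprod A (Fin.cons u ([] : List V).get : Fin 1 → V)) =
        -(β u • PiTensorProduct.tprod A ([] : List V).get) := by
    rw [dTail]
    simp only [List.length_nil, Finset.univ_eq_empty, Finset.sum_empty, zero_add, pow_one,
      LinearMap.smul_apply, faceLast]
    rw [PiTensorProduct.lift.tprod]
    simp only [MultilinearMap.coe_mk, neg_smul, one_smul]
    congr 3
    exact Subsingleton.elim _ _
  rw [this, map_neg, map_smul]; rfl

lemma contractNth_zero_cons {n : ℕ} (u v : V) (f : Fin n → V) :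
    (0 : Fin (n + 1)).castSucc.contractNth (· * ·)
      (Fin.cons u (Fin.cons v f : Fin (n + 1) → V) : Fin (n + 2) → V) = 
      (Fin.cons (u * v) f : Fin (n + 1) → V) := by
  funext i
  refine Fin.cases ?_ (fun i => ?_) i
  · rw [Fin.contractNth_apply_of_eq _ _ _ _ (by simp)]; simp
  · rw [Fin.contractNth_apply_of_gt _ _ _ _ (by simp)]; simp

lemma contractNth_succ_cons {n : ℕ} (j : Fin n) (u : V) (f : Fin (n + 1) → V) :
    j.succ.castSucc.contractNth (· * ·) (Fin.cons u f : Fin (n + 2) → V) = 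
      (Fin.cons u (j.castSucc.contractNth (· * ·) f) : Fin (n + 1) → V) := by
  funext i
  refine Fin.cases ?_ (fun i => ?_) i
  · rw [Fin.contractNth_apply_of_lt _ _ _ _ (by simp)]; simp
  · simp only [Fin.contractNth, Fin.cons_succ]
    simp [← Fin.succ_castSucc]

lemma dTail_cons_cons (β : V →ₗ[A] A) {n : ℕ} (u v : V) (f : Fin n → V) :
    dTail β (n + 1) (PiTensorProduct.tprod A
      (Fin.cons u (Fin.cons v f : Fin (n + 1) → V) : Fin (n + 2) → V)) =
      -PiTensorProduct.tprod A (Fin.cons (u * v) f : Fin (n + 1) → V)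
        - consMap n u (dTail β n (PiTensorProduct.tprod A (Fin.cons v f : Fin (n + 1) → V))) := by
  simp only [dTail, LinearMap.add_apply, LinearMap.sum_apply, LinearMap.smul_apply, faceMid,
    faceLast, PiTensorProduct.lift.tprod, MultilinearMap.coe_mk, map_add, map_sum, map_smul,
    map_smul, consMap_tprod]
  rw [Fin.sum_univ_succ]
  simp only [contractNth_zero_cons, contractNth_succ_cons]
  have h1 : Fin.init (Fin.cons u (Fin.cons v f : Fin (n + 1) → V) : Fin (n + 2) → V) =
      Fin.cons u (Fin.init (Fin.cons v f : Fin (n + 1) → V)) := by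
    funext i
    refine Fin.cases (by simp [Fin.init]) (fun i => ?_) i
    simp [Fin.init, ← Fin.succ_castSucc]
  have h2 : (Fin.cons u (Fin.cons v f : Fin (n + 1) → V) : Fin (n + 2) → V) (Fin.last (n + 1)) =
      (Fin.cons v f : Fin (n + 1) → V) (Fin.last n) := by
    rw [← Fin.succ_last, Fin.cons_succ]
  rw [h1, h2]
  simp only [Fin.val_zero, zero_add, pow_one, neg_smul, one_smul, Fin.val_succ,
    pow_succ (-1 : A) (_ + 1), mul_neg, mul_one, Finset.sum_neg_distrib]
  abel

lemma dTail_word (β : V →ₗ[A] A) (u v : V) (l : List V) :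
    down (dTail β) (word (u :: v :: l)) =
      - word ((u * v) :: l) - L A u (down (dTail β) (word (v :: l))) := by
  have : (word (u :: v :: l) : Tot A V) = DirectSum.lof A ℕ (TPow A V) (l.length + 1 + 1)
      (PiTensorProduct.tprod A (Fin.cons u (Fin.cons v l.get : Fin (l.length + 1) → V) :
        Fin (l.length + 2) → V)) := by
    rw [word_cons, word_cons_eq, L_lof, consMap_tprod]
  rw [this, down_lof, dTail_cons_cons, word_cons_eq, word_cons_eq, down_lof, L_lof, map_sub,
    map_neg]


/-- The `(p, q)`-shuffles: the permutations of `p + q` letters that are increasing on the first `p`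
letters and on the last `q` letters. -/
def shuffles (p q : ℕ) : Finset (Equiv.Perm (Fin (p + q))) :=
  Finset.univ.filter fun σ =>
    StrictMono (fun i : Fin p => σ (Fin.castAdd q i)) ∧
      StrictMono (fun j : Fin q => σ (Fin.natAdd p j))

/-- The shuffle product
`(u¹ ⊗ ⋯ ⊗ u^p, u^{p+1} ⊗ ⋯ ⊗ u^{p+q}) ↦ ∑ sgn(σ) u^{σ⁻¹(1)} ⊗ ⋯ ⊗ u^{σ⁻¹(p+q)}` over all
`(p, q)`-shuffles `σ`, see `shuffleMap_tprod`. If `p` or `q` is `0`, it is the action of `A`. -/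
noncomputable def shuffleMap (p q : ℕ) :
    TPow A V p →ₗ[A] TPow A V q →ₗ[A] TPow A V (p + q) :=
  (TensorProduct.mk A (TPow A V p) (TPow A V q)).compr₂
    ((∑ σ ∈ shuffles p q, ((Equiv.Perm.sign σ : ℤ) : A) •
        (PiTensorProduct.reindex A (fun _ : Fin (p + q) => V) σ).toLinearMap) ∘ₗ
      (TensorPower.mulEquiv (R := A) (M := V) (n := p) (m := q)).toLinearMap)

lemma shuffleMap_tprod (p q : ℕ) (f : Fin p → V) (g : Fin q → V) :
    shuffleMap p q (PiTensorProduct.tprod A f) (PiTensorProduct.tprod A g) =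
      ∑ σ ∈ shuffles p q, ((Equiv.Perm.sign σ : ℤ) : A) •
        PiTensorProduct.tprod A (fun i => Fin.append f g (σ.symm i)) := by
  have : (TensorPower.mulEquiv (R := A) (M := V) (n := p) (m := q))
      (PiTensorProduct.tprod A f ⊗ₜ[A] PiTensorProduct.tprod A g) =
      PiTensorProduct.tprod A (Fin.append f g) := TensorPower.tprod_mul_tprod A f g
  simp only [shuffleMap, LinearMap.compr₂_apply, TensorProduct.mk_apply, LinearMap.comp_apply,
    LinearEquiv.coe_coe, this, LinearMap.sum_apply, LinearMap.smul_apply]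
  refine Finset.sum_congr rfl fun σ _ => ?_
  congr 1
  exact PiTensorProduct.reindex_tprod _ _

/-- Shuffles of `N` letters, the first `p` against the others. -/
def IsShuf (N p : ℕ) (σ : Equiv.Perm (Fin N)) : Prop :=
  ∀ i j : Fin N, i < j → ((j : ℕ) < p ∨ p ≤ (i : ℕ)) → σ i < σ j

lemma mem_shuffles {p q : ℕ} {σ : Equiv.Perm (Fin (p + q))} :
    σ ∈ shuffles p q ↔ IsShuf (p + q) p σ := by
  simp only [shuffles, Finset.mem_filter, Finset.mem_univ, true_and]
  constructor
  · rintro ⟨h1, h2⟩ i j hij h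
    rcases h with h | h
    · exact h1 (a := ⟨i, by omega⟩) (b := ⟨j, h⟩) hij
    · have := h2 (a := ⟨i - p, by omega⟩) (b := ⟨j - p, by omega⟩) (by
        simp only [Fin.lt_def]; omega)
      have e1 : Fin.natAdd p (⟨i - p, by omega⟩ : Fin q) = i := by ext; simp; omega
      have e2 : Fin.natAdd p (⟨j - p, by omega⟩ : Fin q) = j := by ext; simp; omega
      simpa only [e1, e2] using this
  · intro h
    refine ⟨fun i j hij => h _ _ ?_ (Or.inl ?_), fun i j hij => h _ _ ?_ (Or.inr ?_)⟩
    · rw [Fin.lt_def] at hij ⊢; simpa using hij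
    · simp
    · rw [Fin.lt_def] at hij ⊢; simpa using hij
    · simp

/-- The permutation that sends `d` to `0` and is `e` on the remaining letters. -/
def insPerm {N : ℕ} (d : Fin (N + 1)) (e : Equiv.Perm (Fin N)) : Equiv.Perm (Fin (N + 1)) :=
  Equiv.Perm.decomposeFin.symm (0, e) * d.cycleRange

lemma insPerm_self {N : ℕ} (d : Fin (N + 1)) (e : Equiv.Perm (Fin N)) : insPerm d e d = 0 := by
  simp [insPerm]

lemma insPerm_succAbove {N : ℕ} (d : Fin (N + 1)) (e : Equiv.Perm (Fin N)) (j : Fin N) :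
    insPerm d e (d.succAbove j) = (e j).succ := by
  simp [insPerm]

lemma insPerm_symm_zero {N : ℕ} (d : Fin (N + 1)) (e : Equiv.Perm (Fin N)) :
    (insPerm d e).symm 0 = d := by
  rw [Equiv.symm_apply_eq, insPerm_self]

lemma insPerm_symm_succ {N : ℕ} (d : Fin (N + 1)) (e : Equiv.Perm (Fin N)) (j : Fin N) :
    (insPerm d e).symm j.succ = d.succAbove (e.symm j) := by
  rw [Equiv.symm_apply_eq, insPerm_succAbove, Equiv.apply_symm_apply]

lemma sign_insPerm {N : ℕ} (d : Fin (N + 1)) (e : Equiv.Perm (Fin N)) :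
    Equiv.Perm.sign (insPerm d e) = (-1) ^ (d : ℕ) * Equiv.Perm.sign e := by
  simp [insPerm, Equiv.Perm.decomposeFin.symm_sign, mul_comm]

lemma insPerm_bijective (N : ℕ) : Function.Bijective
    (fun x : Fin (N + 1) × Equiv.Perm (Fin N) => insPerm x.1 x.2) := by
  rw [Fintype.bijective_iff_injective_and_card]
  refine ⟨?_, ?_⟩
  · rintro ⟨d, e⟩ ⟨d', e'⟩ h
    simp only at h
    have hd : d = d' := by rw [← insPerm_symm_zero d e, h, insPerm_symm_zero]
    subst hd
    have : e = e' := by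
      ext j
      have := congrArg (fun σ => σ (d.succAbove j)) h
      simp only [insPerm_succAbove] at this
      rw [Fin.succ_injective _ this]
    rw [this]
  · rw [Fintype.card_prod, Fintype.card_perm, Fintype.card_perm, Fintype.card_fin,
      Fintype.card_fin, Nat.factorial_succ]

lemma isShuf_ins_zero {N p : ℕ} (e : Equiv.Perm (Fin N)) :
    IsShuf (N + 1) (p + 1) (insPerm 0 e) ↔ IsShuf N p e := by
  have h0 := insPerm_self 0 e
  have hs : ∀ j, insPerm 0 e (Fin.succ j) = (e j).succ := fun j => by
    rw [← Fin.succAbove_zero, insPerm_succAbove, Fin.succAbove_zero]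
  constructor
  · intro h i j hij hc
    have := h i.succ j.succ (by simpa using hij) (by simpa using hc)
    rw [hs, hs] at this
    simpa using this
  · intro h i j
    refine Fin.cases ?_ (fun i => ?_) i <;> refine Fin.cases ?_ (fun j => ?_) j
    · intro hij; exact absurd hij (lt_irrefl _)
    · intro _ _; rw [h0, hs]; exact Fin.succ_pos _
    · intro hij; exact absurd hij (by simp)
    · intro hij hc
      rw [hs, hs]
      have := h i j (by simpa using hij) (by simpa using hc)
      simpa using this

lemma val_succAbove {N : ℕ} (d : Fin (N + 1)) (j : Fin N) :
    ((d.succAbove j : Fin (N + 1)) : ℕ) = if (j : ℕ) < d then (j : ℕ) else j + 1 := by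
  simp only [Fin.succAbove, Fin.lt_def, Fin.val_castSucc]
  split_ifs <;> simp

lemma isShuf_ins {N p : ℕ} (d : Fin (N + 1)) (hd : (d : ℕ) = p + 1) (e : Equiv.Perm (Fin N)) :
    IsShuf (N + 1) (p + 1) (insPerm d e) ↔ IsShuf N (p + 1) e := by
  constructor
  · intro h i j hij hc
    have := h (d.succAbove i) (d.succAbove j) (by simpa using hij) (by
      rw [val_succAbove, val_succAbove, hd]; split_ifs <;> omega)
    rw [insPerm_succAbove, insPerm_succAbove] at this
    simpa using this
  · intro h i j hij hc
    by_cases hi : i = d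
    · subst hi
      obtain ⟨j, rfl⟩ := Fin.exists_succAbove_eq (ne_of_gt hij)
      rw [insPerm_self, insPerm_succAbove]; exact Fin.succ_pos _
    · by_cases hj : j = d
      · subst hj
        rw [Fin.lt_def] at hij
        omega
      · obtain ⟨i, rfl⟩ := Fin.exists_succAbove_eq hi
        obtain ⟨j, rfl⟩ := Fin.exists_succAbove_eq hj
        rw [insPerm_succAbove, insPerm_succAbove]
        have := h i j (by simpa using hij) (by
          rw [val_succAbove, val_succAbove, hd] at hc
          rw [Fin.lt_def, val_succAbove, val_succAbove, hd] at hij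
          split_ifs at hc hij <;> omega)
        simpa using this

lemma not_isShuf_ins {N p : ℕ} (d : Fin (N + 1)) (h0 : (d : ℕ) ≠ 0) (hd : (d : ℕ) ≠ p + 1)
    (e : Equiv.Perm (Fin N)) : ¬ IsShuf (N + 1) (p + 1) (insPerm d e) := by
  intro h
  have := h ⟨d - 1, by omega⟩ d (by rw [Fin.lt_def]; simp only; omega) (by simp only; omega)
  rw [insPerm_self] at this
  exact absurd this (by simp)

open Classical in
/-- Signed sum over shuffles -/
noncomputable def shufSum (N p : ℕ) (c : Fin N → V) : Tot A V :=
  ∑ σ : Equiv.Perm (Fin N), if IsShuf N p σ then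
    ((Equiv.Perm.sign σ : ℤ) : A) • word (List.ofFn fun i => c (σ.symm i)) else 0

lemma shufSum_congr {N M p : ℕ} (h : N = M) (c : Fin N → V) (c' : Fin M → V)
    (hc : ∀ i, c i = c' (Fin.cast h i)) : (shufSum N p c : Tot A V) = shufSum M p c' := by
  subst h
  congr 1
  funext i
  exact hc i

lemma shufSum_rec {N p : ℕ} (c : Fin (N + 1) → V) (d : Fin (N + 1)) (hd : (d : ℕ) = p + 1) :
    (shufSum (N + 1) (p + 1) c : Tot A V) =
      L A (c 0) (shufSum N p (fun i => c i.succ)) +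
        (-1 : A) ^ (p + 1) • L A (c d) (shufSum N (p + 1) (fun i => c (d.succAbove i))) := by
  rw [shufSum, ← (insPerm_bijective N).sum_comp, Fintype.sum_prod_type]
  rw [Fintype.sum_eq_add 0 d (by intro h; rw [← h] at hd; simp at hd)]
  · congr 1
    · simp only [shufSum, map_sum]
      refine Finset.sum_congr rfl fun e _ => ?_
      by_cases he : IsShuf N p e
      · rw [if_pos he, if_pos ((isShuf_ins_zero e).2 he), map_smul, ← word_cons, List.ofFn_succ, sign_insPerm, insPerm_symm_zero]
        simp [insPerm_symm_succ]
      · rw [if_neg he, if_neg (fun h => he ((isShuf_ins_zero e).1 h)), map_zero]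
    · simp only [shufSum, map_sum, Finset.smul_sum]
      refine Finset.sum_congr rfl fun e _ => ?_
      by_cases he : IsShuf N (p + 1) e
      · rw [if_pos he, if_pos ((isShuf_ins d hd e).2 he), map_smul, ← word_cons, List.ofFn_succ, sign_insPerm, insPerm_symm_zero, smul_smul]
        simp [insPerm_symm_succ, hd]
      · rw [if_neg he, if_neg (fun h => he ((isShuf_ins d hd e).1 h)), map_zero, smul_zero]
  · rintro x ⟨h0, h1⟩
    refine Finset.sum_eq_zero fun e _ => if_neg (not_isShuf_ins x ?_ ?_ e)
    · intro h; exact h0 (Fin.ext h)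
    · intro h; exact h1 (Fin.ext (h.trans hd.symm))

variable (A V) in
/-- total shuffle product -/
noncomputable def shT : Tot A V →ₗ[A] Tot A V →ₗ[A] Tot A V :=
  DirectSum.toModule A ℕ _ fun p => LinearMap.flip <| DirectSum.toModule A ℕ _ fun q =>
    LinearMap.flip <| (shuffleMap p q).compr₂ (DirectSum.lof A ℕ (TPow A V) (p + q))

lemma shT_lof {p q : ℕ} (x : TPow A V p) (y : TPow A V q) :
    shT A V (DirectSum.lof A ℕ (TPow A V) p x) (DirectSum.lof A ℕ (TPow A V) q y) =
      DirectSum.lof A ℕ (TPow A V) (p + q) (shuffleMap p q x y) := by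
  rw [shT, DirectSum.toModule_lof, LinearMap.flip_apply, DirectSum.toModule_lof,
    LinearMap.flip_apply, LinearMap.compr₂_apply]

lemma append_get {V : Type*} (a b : List V) (i : Fin (a.length + b.length)) :
    Fin.append a.get b.get i = (a ++ b)[(i : ℕ)]'(by simp) := by
  refine Fin.addCases (fun i => ?_) (fun i => ?_) i
  · simp
  · simp

lemma shT_word (a b : List V) : shT A V (word a) (word b) =
    shufSum (a.length + b.length) a.length (Fin.append a.get b.get) := by
  classical
  rw [word, word, shT_lof, shuffleMap_tprod, map_sum, shufSum, ← Finset.sum_filter]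
  refine Finset.sum_congr ?_ fun σ _ => ?_
  · ext σ
    rw [mem_shuffles]
    simp
  · rw [map_smul, lof_tprod]

lemma shufSum_trivial {N p : ℕ} (hp : p = 0 ∨ N ≤ p) (c : Fin N → V) :
    (shufSum N p c : Tot A V) = word (List.ofFn c) := by
  classical
  have key : ∀ σ : Equiv.Perm (Fin N), IsShuf N p σ ↔ σ = 1 := by
    refine fun σ => ⟨fun h => ?_, ?_⟩
    · have hm : StrictMono σ := fun i j hij => h i j hij (by omega)
      have := (StrictMono.range_inj hm strictMono_id).1 (by simp)
      exact Equiv.ext (congrFun this)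
    · rintro rfl i j hij _
      exact hij
  rw [shufSum, Finset.sum_eq_single 1]
  · rw [if_pos ((key 1).2 rfl)]
    simp
    rfl
  · intro σ _ h
    rw [if_neg (fun h' => h ((key σ).1 h'))]
  · simp

lemma shT_nil_left (x : Tot A V) : shT A V (word []) x = x := by
  have : shT A V (word []) = LinearMap.id := by
    refine tot_ext fun l => ?_
    rw [shT_word]
    refine (shufSum_trivial (Or.inl rfl) _).trans ?_
    simp only [List.ofFn_fin_append, List.ofFn_get, List.nil_append]
    rfl
  rw [this, LinearMap.id_apply]

lemma shT_nil_right (x : Tot A V) : shT A V x (word []) = x := by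
  have : (shT A V).flip (word []) = LinearMap.id := by
    refine tot_ext fun l => ?_
    rw [LinearMap.flip_apply, shT_word, shufSum_trivial (Or.inr (by simp))]
    simp only [List.ofFn_fin_append, List.ofFn_get, List.append_nil]
    rfl
  exact LinearMap.congr_fun this x

lemma shT_cons_word (u v : V) (a b : List V) :
    shT A V (word (u :: a)) (word (v :: b)) =
      L A u (shT A V (word a) (word (v :: b))) +
        L A v (shT A V (J A V (word (u :: a))) (word b)) := by
  rw [J_word, map_smul, LinearMap.smul_apply, map_smul, shT_word, shT_word, shT_word]
  have hd : a.length + 1 < (a.length + 1 + b.length) + 1 := by omega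
  rw [show shufSum ((u :: a).length + (v :: b).length) (u :: a).length
      (Fin.append (u :: a).get (v :: b).get) = _ from
      shufSum_rec (N := a.length + 1 + b.length) (p := a.length) _ ⟨a.length + 1, hd⟩ rfl]
  congr 1
  · refine congrArg (fun z : Tot A V => L A u z) ?_
    refine shufSum_congr (by simp; omega) _ _ fun i => ?_
    rw [append_get, append_get]
    simp
  · congr 1
    congr 1
    · congr 1
      rw [append_get]
      simp
    · refine shufSum_congr (by simp) _ _ fun i => ?_
      rw [append_get, append_get]
      simp only [val_succAbove]
      split_ifs with h
      · simp only [Fin.val_cast, List.getElem_append, List.length_cons, h, dite_true]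
      · simp only [not_lt] at h
        obtain ⟨m, hm⟩ := Nat.exists_eq_add_of_le h
        simp only [Fin.val_cast, List.getElem_append, List.length_cons, hm]
        rw [dif_neg (by omega), dif_neg (by omega)]
        have e1 : a.length + 1 + m + 1 - (a.length + 1) = m + 1 := by omega
        have e2 : a.length + 1 + m - (a.length + 1) = m := by omega
        simp only [e1, e2, List.getElem_cons_succ]

lemma shT_L_L (u v : V) (x y : Tot A V) :
    shT A V (L A u x) (L A v y) =
      L A u (shT A V x (L A v y)) + L A v (shT A V (J A V (L A u x)) y) := by
  have key : (shT A V).compl₁₂ (L A u) (L A v) = ((shT A V).compl₂ (L A v)).compr₂ (L A u) +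
      ((shT A V).comp (J A V ∘ₗ L A u)).compr₂ (L A v) := by
    refine tot_ext fun a => tot_ext fun b => ?_
    simp only [LinearMap.compl₁₂_apply, LinearMap.add_apply, LinearMap.compr₂_apply,
      LinearMap.compl₂_apply, LinearMap.comp_apply, ← word_cons]
    exact shT_cons_word u v a b
  exact LinearMap.congr_fun (LinearMap.congr_fun key x) y

lemma shuffleRules : ShuffleRules (A := A) (M := Tot A V) word (L A) (J A V) (shT A V) where
  word_cons := word_cons
  J_word := J_word
  J_L := J_L
  nil_sh := shT_nil_left
  sh_nil := shT_nil_right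
  sh_LL := shT_L_L

lemma bilin_ext {X : Type*} [AddCommMonoid X] [Module A X] {f g : Tot A V →ₗ[A] Tot A V →ₗ[A] X}
    (h : ∀ a b, f (word a) (word b) = g (word a) (word b)) (x y : Tot A V) : f x y = g x y := by
  have : f = g := tot_ext fun a => tot_ext fun b => h a b
  rw [this]

lemma shT_assoc (x y z : Tot A V) :
    shT A V (shT A V x y) z = shT A V x (shT A V y z) := by
  have h1 : ∀ z a b, shT A V (shT A V (word a) (word b)) z =
      shT A V (word a) (shT A V (word b) z) := by
    intro z a b
    have : shT A V (shT A V (word a) (word b)) = shT A V (word a) ∘ₗ shT A V (word b) :=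
      tot_ext fun c => shuffleRules.assoc a b c
    exact LinearMap.congr_fun this z
  have := bilin_ext (f := (shT A V).compr₂ ((shT A V).flip z))
    (g := (shT A V).compl₂ ((shT A V).flip z)) (fun a b => h1 z a b) x y
  exact this

/-- The total differential. -/
noncomputable def dT (α β : V →ₗ[A] A) : Tot A V →ₗ[A] Tot A V := down (bar_d α β)

lemma dT_eq (α β : V →ₗ[A] A) : dT α β = down (faceFirst α) + down (dTail β) := by
  refine DirectSum.linearMap_ext A fun n => LinearMap.ext fun x => ?_
  cases n with
  | zero => simp only [dT, LinearMap.comp_apply, LinearMap.add_apply, down_lof_zero, add_zero]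
  | succ n =>
    simp only [dT, LinearMap.comp_apply, LinearMap.add_apply, down_lof, ← map_add]
    rw [bar_d, dTail, add_assoc]; rfl

lemma dTail_L (β : V →ₗ[A] A) (u v : V) (x : Tot A V) :
    down (dTail β) (L A u (L A v x)) = -L A (u * v) x - L A u (down (dTail β) (L A v x)) := by
  have : down (dTail β) ∘ₗ L A u ∘ₗ L A v =
      -L A (u * v) - L A u ∘ₗ down (dTail β) ∘ₗ L A v := by
    refine tot_ext fun l => ?_
    simp only [LinearMap.comp_apply, LinearMap.sub_apply, LinearMap.neg_apply, ← word_cons]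
    exact dTail_word β u v l
  exact LinearMap.congr_fun this x

lemma dFirst_L (α : V →ₗ[A] A) (u : V) (x : Tot A V) :
    down (faceFirst α) (L A u x) = α u • x := by
  have : down (faceFirst α) ∘ₗ L A u = α u • LinearMap.id := by
    refine tot_ext fun l => ?_
    rw [LinearMap.comp_apply, ← word_cons, faceFirst_word]
    rfl
  exact LinearMap.congr_fun this x

lemma leibniz_word (α β : V →ₗ[A] A) (a b : List V) :
    dT α β (shT A V (word a) (word b)) =
      shT A V (dT α β (word a)) (word b) + shT A V (J A V (word a)) (dT α β (word b)) := by
  have h1 := (shuffleRules (A := A) (V := V)).leibniz_first (down (faceFirst α)) α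
    (down_word_nil _) (dFirst_L α) a b
  have h2 := leibniz_tail (shuffleRules (A := A) (V := V)) (down (dTail β)) β
    (down_word_nil _) (J_down _) (fun u => -(down (dTail β) ∘ₗ L A u) - L A u ∘ₗ down (dTail β))
    (fun u x => by
      simp only [LinearMap.sub_apply, LinearMap.neg_apply, LinearMap.comp_apply]; abel)
    (fun u => by
      simp only [LinearMap.sub_apply, LinearMap.neg_apply, LinearMap.comp_apply, ← word_cons,
        dTail_word_one, down_word_nil, map_zero]; simp)
    (fun u v x => by
      simp only [LinearMap.sub_apply, LinearMap.neg_apply, LinearMap.comp_apply, dTail_L]; abel)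
    a b
  rw [dT_eq]
  simp only [LinearMap.add_apply, map_add]
  rw [h1, h2]
  abel

lemma leibniz (α β : V →ₗ[A] A) (x y : Tot A V) :
    dT α β (shT A V x y) = shT A V (dT α β x) y + shT A V (J A V x) (dT α β y) :=
  bilin_ext (f := (shT A V).compr₂ (dT α β))
    (g := (shT A V).comp (dT α β) + (shT A V).compl₁₂ (J A V) (dT α β))
    (leibniz_word α β) x y



section Homology

variable {k : Type*} [CommRing k] [Algebra k A]

/-- The differential as a `k`-linear map. -/
noncomputable def barDk (k : Type*) [CommRing k] [Algebra k A] (α β : V →ₗ[A] A) (n : ℕ) :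
    TPow A V (n + 1) →ₗ[k] TPow A V n :=
  (bar_d α β n).restrictScalars k

/-- Cycles in degree `n`. -/
noncomputable def cycles (k : Type*) [CommRing k] [Algebra k A] (α β : V →ₗ[A] A) :
    ∀ n, Submodule k (TPow A V n)
  | 0 => ⊤
  | n + 1 => LinearMap.ker (barDk k α β n)

/-- Boundaries in degree `n`. -/
noncomputable def boundaries (k : Type*) [CommRing k] [Algebra k A] (α β : V →ₗ[A] A) (n : ℕ) :
    Submodule k (TPow A V n) :=
  LinearMap.range (barDk k α β n)

variable {α β : V →ₗ[A] A}

lemma lof_inj {n : ℕ} {x y : TPow A V n}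
    (h : DirectSum.lof A ℕ (TPow A V) n x = DirectSum.lof A ℕ (TPow A V) n y) : x = y :=
  DirectSum.of_injective (β := TPow A V) n h

lemma mem_cycles {n : ℕ} {x : TPow A V n} :
    x ∈ cycles k α β n ↔ dT α β (DirectSum.lof A ℕ (TPow A V) n x) = 0 := by
  cases n with
  | zero => simp only [cycles, Submodule.mem_top, dT, down_lof_zero]
  | succ n =>
    simp only [cycles, LinearMap.mem_ker, dT, down_lof]
    constructor
    · intro h
      have h' : bar_d α β n x = 0 := h
      rw [h', map_zero]
    · intro h
      exact lof_inj (h.trans (map_zero _).symm)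

lemma dT_component (w : Tot A V) (n : ℕ) : (dT α β w) n = bar_d α β n (w (n + 1)) := by
  have : DirectSum.component A ℕ (TPow A V) n ∘ₗ dT α β =
      bar_d α β n ∘ₗ DirectSum.component A ℕ (TPow A V) (n + 1) := by
    refine DirectSum.linearMap_ext A fun m => LinearMap.ext fun x => ?_
    cases m with
    | zero =>
      simp only [LinearMap.comp_apply, dT, down_lof_zero, map_zero]
      rw [DirectSum.component.of, dif_neg (by omega), map_zero]
    | succ m =>
      simp only [LinearMap.comp_apply, dT, down_lof]
      by_cases h : m = n
      · subst h
        rw [DirectSum.component.lof_self, DirectSum.component.lof_self]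
      · rw [DirectSum.component.of, DirectSum.component.of, dif_neg h, dif_neg (by omega), map_zero]
  exact LinearMap.congr_fun this w

lemma mem_boundaries {n : ℕ} {x : TPow A V n} :
    x ∈ boundaries k α β n ↔ ∃ w, dT α β w = DirectSum.lof A ℕ (TPow A V) n x := by
  constructor
  · rintro ⟨w, rfl⟩
    exact ⟨DirectSum.lof A ℕ (TPow A V) (n + 1) w, down_lof _ _ _⟩
  · rintro ⟨w, hw⟩
    refine ⟨w (n + 1), ?_⟩
    have := dT_component (α := α) (β := β) w n
    rw [hw] at this
    exact this.symm.trans (DirectSum.component.lof_self A (M := TPow A V) n x)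

lemma shuffleMap_mem_cycles {p q : ℕ} {x : TPow A V p} {y : TPow A V q}
    (hx : x ∈ cycles k α β p) (hy : y ∈ cycles k α β q) :
    shuffleMap p q x y ∈ cycles k α β (p + q) := by
  rw [mem_cycles] at *
  rw [← shT_lof, leibniz, hx, hy, map_zero, map_zero, LinearMap.zero_apply, add_zero]

lemma J_J (x : Tot A V) : J A V (J A V x) = x := by
  have : J A V ∘ₗ J A V = LinearMap.id := by
    refine tot_ext fun l => ?_
    rw [LinearMap.comp_apply, J_word, map_smul, J_word, smul_smul, ← mul_pow]
    simp
  exact LinearMap.congr_fun this x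

lemma shuffleMap_mem_boundaries_left {p q : ℕ} {x : TPow A V p} {y : TPow A V q}
    (hx : x ∈ boundaries k α β p) (hy : y ∈ cycles k α β q) :
    shuffleMap p q x y ∈ boundaries k α β (p + q) := by
  rw [mem_cycles] at *
  rw [mem_boundaries] at *
  obtain ⟨w, hw⟩ := hx
  refine ⟨shT A V w (DirectSum.lof A ℕ (TPow A V) q y), ?_⟩
  rw [leibniz, hy, map_zero, add_zero, hw, shT_lof]

lemma shuffleMap_mem_boundaries_right {p q : ℕ} {x : TPow A V p} {y : TPow A V q}
    (hx : x ∈ cycles k α β p) (hy : y ∈ boundaries k α β q) :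
    shuffleMap p q x y ∈ boundaries k α β (p + q) := by
  rw [mem_cycles] at *
  rw [mem_boundaries] at *
  obtain ⟨w, hw⟩ := hy
  refine ⟨shT A V (J A V (DirectSum.lof A ℕ (TPow A V) p x)) w, ?_⟩
  have hJ : dT α β (J A V (DirectSum.lof A ℕ (TPow A V) p x)) = 0 := by
    rw [J_lof, map_smul, hx, smul_zero]
  rw [leibniz, hJ, map_zero, LinearMap.zero_apply, zero_add, J_J, hw, shT_lof]

/-- The homology in degree `n` of the complex with differential `bar_d α β`: cycles modulo
boundaries. -/
def BarHH (k : Type*) [CommRing k] [Algebra k A] (α β : V →ₗ[A] A) (n : ℕ) : Type _ :=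
  cycles k α β n ⧸ (boundaries k α β n).submoduleOf (cycles k α β n)

noncomputable instance (n : ℕ) : AddCommGroup (BarHH k α β n) :=
  inferInstanceAs (AddCommGroup (cycles k α β n ⧸ (boundaries k α β n).submoduleOf (cycles k α β n)))

noncomputable instance (n : ℕ) : Module k (BarHH k α β n) :=
  inferInstanceAs (Module k (cycles k α β n ⧸ (boundaries k α β n).submoduleOf (cycles k α β n)))

/-- The homology class of a cycle. -/
noncomputable def BarHH.mk (n : ℕ) : cycles k α β n →ₗ[k] BarHH k α β n :=
  Submodule.mkQ _

lemma BarHH.mk_surjective (n : ℕ) : Function.Surjective (BarHH.mk (k := k) (α := α) (β := β) n) :=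
  Submodule.mkQ_surjective _

/-- The shuffle product of cycles. -/
noncomputable def cyclesMul (p q : ℕ) :
    cycles k α β p →ₗ[k] cycles k α β q →ₗ[k] cycles k α β (p + q) :=
  LinearMap.mk₂ k (fun x y => ⟨shuffleMap p q x.1 y.1, shuffleMap_mem_cycles x.2 y.2⟩)
    (fun x x' y => Subtype.ext (by simp))
    (fun c x y => Subtype.ext (by
      have : shuffleMap p q (c • x.1) y.1 = c • shuffleMap p q x.1 y.1 := by
        rw [← algebraMap_smul A c x.1, map_smul, LinearMap.smul_apply, algebraMap_smul]
      exact this))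
    (fun x y y' => Subtype.ext (by simp))
    (fun c x y => Subtype.ext (by
      have : shuffleMap p q x.1 (c • y.1) = c • shuffleMap p q x.1 y.1 := by
        rw [← algebraMap_smul A c y.1, map_smul, algebraMap_smul]
      exact this))

/-- The shuffle product on homology. -/
noncomputable def BarHH.mul (p q : ℕ) :
    BarHH k α β p →ₗ[k] BarHH k α β q →ₗ[k] BarHH k α β (p + q) :=
  Submodule.liftQ _
    (LinearMap.flip (Submodule.liftQ _ (LinearMap.flip ((cyclesMul p q).compr₂ (BarHH.mk (p + q))))
      (fun y hy => by
        rw [LinearMap.mem_ker]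
        refine LinearMap.ext fun x => ?_
        exact (Submodule.Quotient.mk_eq_zero _).2
          (shuffleMap_mem_boundaries_right x.2 hy))))
    (fun x hx => by
      rw [LinearMap.mem_ker]
      refine LinearMap.ext fun y => ?_
      obtain ⟨y, rfl⟩ := BarHH.mk_surjective q y
      exact (Submodule.Quotient.mk_eq_zero _).2
          (shuffleMap_mem_boundaries_left hx y.2))

lemma BarHH.mul_mk {p q : ℕ} (x : cycles k α β p) (y : cycles k α β q) :
    BarHH.mul p q (BarHH.mk p x) (BarHH.mk q y) =
      BarHH.mk (p + q) ⟨shuffleMap p q x.1 y.1, shuffleMap_mem_cycles x.2 y.2⟩ := rfl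

lemma BarHH.mk_congr {m n : ℕ} {x : cycles k α β m} {y : cycles k α β n} (h : m = n)
    (hxy : DirectSum.lof A ℕ (TPow A V) m x.1 = DirectSum.lof A ℕ (TPow A V) n y.1) :
    GradedMonoid.mk (A := BarHH k α β) m (BarHH.mk m x) = GradedMonoid.mk n (BarHH.mk n y) := by
  subst h
  obtain rfl : x = y := Subtype.ext (lof_inj hxy)
  rfl

/-- The unit `1` of `A = C_0`, as a cycle. -/
noncomputable def cyclesOne (k : Type*) [CommRing k] [Algebra k A] (α β : V →ₗ[A] A) :
    cycles k α β 0 :=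
  ⟨PiTensorProduct.tprod A (fun i : Fin 0 => i.elim0), Submodule.mem_top⟩

lemma lof_one : DirectSum.lof A ℕ (TPow A V) 0 (cyclesOne k α β).1 = word [] := by
  rw [cyclesOne, lof_tprod]; simp

noncomputable instance : GradedMonoid.GOne (BarHH k α β) where
  one := BarHH.mk 0 (cyclesOne k α β)

noncomputable instance : GradedMonoid.GMul (BarHH k α β) where
  mul {p q} x y := BarHH.mul p q x y

lemma BarHH.one_mul' {n : ℕ} (x : BarHH k α β n) :
    GradedMonoid.mk (0 + n) (BarHH.mul 0 n (BarHH.mk 0 (cyclesOne k α β)) x) =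
      GradedMonoid.mk n x := by
  obtain ⟨x, rfl⟩ := BarHH.mk_surjective n x
  rw [BarHH.mul_mk]
  refine BarHH.mk_congr (zero_add n) ?_
  rw [← shT_lof, lof_one, shT_nil_left]

lemma BarHH.mul_one' {n : ℕ} (x : BarHH k α β n) :
    GradedMonoid.mk (n + 0) (BarHH.mul n 0 x (BarHH.mk 0 (cyclesOne k α β))) =
      GradedMonoid.mk n x := by
  obtain ⟨x, rfl⟩ := BarHH.mk_surjective n x
  rw [BarHH.mul_mk]
  refine BarHH.mk_congr (add_zero n) ?_
  rw [← shT_lof, lof_one, shT_nil_right]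

lemma BarHH.mul_assoc' {l m n : ℕ} (x : BarHH k α β l) (y : BarHH k α β m) (z : BarHH k α β n) :
    GradedMonoid.mk (l + m + n) (BarHH.mul (l + m) n (BarHH.mul l m x y) z) =
      GradedMonoid.mk (l + (m + n)) (BarHH.mul l (m + n) x (BarHH.mul m n y z)) := by
  obtain ⟨x, rfl⟩ := BarHH.mk_surjective l x
  obtain ⟨y, rfl⟩ := BarHH.mk_surjective m y
  obtain ⟨z, rfl⟩ := BarHH.mk_surjective n z
  simp only [BarHH.mul_mk]
  refine BarHH.mk_congr (add_assoc l m n) ?_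
  simp only [← shT_lof, shT_assoc]

noncomputable instance : GradedMonoid.GMonoid (BarHH k α β) where
  one_mul := fun x => BarHH.one_mul' x.2
  mul_one := fun x => BarHH.mul_one' x.2
  mul_assoc := fun x y z => BarHH.mul_assoc' x.2 y.2 z.2

noncomputable instance : DirectSum.GRing (BarHH k α β) where
  mul_zero {p q} x := map_zero (BarHH.mul p q x)
  zero_mul {p q} y := LinearMap.congr_fun (map_zero (BarHH.mul p q)) y
  mul_add {p q} x y z := map_add (BarHH.mul p q x) y z
  add_mul {p q} x y z := LinearMap.congr_fun (map_add (BarHH.mul p q) x y) z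
  natCast n := n • BarHH.mk 0 (cyclesOne k α β)
  natCast_zero := zero_smul _ _
  natCast_succ n := succ_nsmul _ _
  intCast n := n • BarHH.mk 0 (cyclesOne k α β)
  intCast_ofNat n := natCast_zsmul _ _
  intCast_negSucc_ofNat n := negSucc_zsmul _ _

lemma BarHH.mk_smul_congr {m n : ℕ} {x : BarHH k α β m} {y : BarHH k α β n} (r : k)
    (h : GradedMonoid.mk (A := BarHH k α β) m x = GradedMonoid.mk n y) :
    GradedMonoid.mk (A := BarHH k α β) m (r • x) = GradedMonoid.mk n (r • y) := by
  obtain ⟨h1, h2⟩ := Sigma.mk.inj_iff.1 h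
  subst h1
  rw [eq_of_heq h2]

noncomputable instance : DirectSum.GAlgebra k (BarHH k α β) where
  toFun := ((LinearMap.id : k →ₗ[k] k).smulRight (BarHH.mk 0 (cyclesOne k α β))).toAddMonoidHom
  map_one := one_smul k (BarHH.mk 0 (cyclesOne k α β))
  map_mul r s := by
    refine Eq.trans ?_ (BarHH.mk_smul_congr r (BarHH.one_mul'
      (s • BarHH.mk 0 (cyclesOne k α β)))).symm |>.trans ?_
    · exact congrArg (GradedMonoid.mk 0) (mul_smul r s (BarHH.mk 0 (cyclesOne k α β)))
    · exact congrArg (GradedMonoid.mk (0 + 0)) (LinearMap.map_smul₂ (BarHH.mul 0 0) r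
        (BarHH.mk 0 (cyclesOne k α β)) (s • BarHH.mk 0 (cyclesOne k α β))).symm
  commutes r := fun ⟨n, x⟩ =>
    ((congrArg (GradedMonoid.mk (0 + n)) (LinearMap.map_smul₂ (BarHH.mul 0 n) r
        (BarHH.mk 0 (cyclesOne k α β)) x)).trans
      ((BarHH.mk_smul_congr r (BarHH.one_mul' x)).trans
        (BarHH.mk_smul_congr r (BarHH.mul_one' x)).symm)).trans
      (congrArg (GradedMonoid.mk (n + 0)) (map_smul (BarHH.mul n 0 x) r
        (BarHH.mk 0 (cyclesOne k α β))).symm)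
  smul_def r := fun ⟨n, x⟩ =>
    (BarHH.mk_smul_congr r (BarHH.one_mul' x)).symm.trans
      (congrArg (GradedMonoid.mk (0 + n)) (LinearMap.map_smul₂ (BarHH.mul 0 n) r
        (BarHH.mk 0 (cyclesOne k α β)) x).symm)


end Homology
end Bar


/- Convolution along the coproduct of a coalgebra. -/
section Conv
variable {k C : Type*} [CommRing k] [AddCommGroup C] [Module k C] [Coalgebra k C]
variable {X Y Z P Q : Type*} [AddCommGroup X] [Module k X] [AddCommGroup Y] [Module k Y]
  [AddCommGroup Z] [Module k Z] [AddCommGroup P] [Module k P] [AddCommGroup Q] [Module k Q]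

/-- `x ↦ ∑ b (F x₁) (G x₂)`, where `Δ x = ∑ x₁ ⊗ x₂` is the coproduct of the coalgebra `C`. -/
noncomputable def conv (b : X →ₗ[k] Y →ₗ[k] Z) (F : C →ₗ[k] X) (G : C →ₗ[k] Y) : C →ₗ[k] Z :=
  TensorProduct.lift b ∘ₗ TensorProduct.map F G ∘ₗ Coalgebra.comul

lemma conv_apply_repr (b : X →ₗ[k] Y →ₗ[k] Z) (F : C →ₗ[k] X) (G : C →ₗ[k] Y) (x : C)
    {ι : Type*} (r : Coalgebra.Repr k x ι) :
    conv b F G x = ∑ i ∈ r.index, b (F (r.left i)) (G (r.right i)) := by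
  rw [conv, LinearMap.comp_apply, LinearMap.comp_apply, ← r.eq]
  simp

lemma conv_add_left (b : X →ₗ[k] Y →ₗ[k] Z) (F F' : C →ₗ[k] X) (G : C →ₗ[k] Y) :
    conv b (F + F') G = conv b F G + conv b F' G := by
  simp only [conv, TensorProduct.map_add_left, LinearMap.add_comp, LinearMap.comp_add]

lemma conv_add_right (b : X →ₗ[k] Y →ₗ[k] Z) (F : C →ₗ[k] X) (G G' : C →ₗ[k] Y) :
    conv b F (G + G') = conv b F G + conv b F G' := by
  simp only [conv, TensorProduct.map_add_right, LinearMap.add_comp, LinearMap.comp_add]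

lemma conv_smul_left (b : X →ₗ[k] Y →ₗ[k] Z) (c : k) (F : C →ₗ[k] X) (G : C →ₗ[k] Y) :
    conv b (c • F) G = c • conv b F G := by
  simp only [conv, TensorProduct.map_smul_left, LinearMap.smul_comp, LinearMap.comp_smul]

lemma conv_zero_left (b : X →ₗ[k] Y →ₗ[k] Z) (G : C →ₗ[k] Y) : conv b 0 G = 0 := by
  simpa using conv_smul_left b (0 : k) 0 G

lemma conv_zero_right (b : X →ₗ[k] Y →ₗ[k] Z) (F : C →ₗ[k] X) :
    conv b F (0 : C →ₗ[k] Y) = 0 := by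
  simp only [conv, TensorProduct.map_zero_right, LinearMap.zero_comp, LinearMap.comp_zero]

lemma comp_conv (b : X →ₗ[k] Y →ₗ[k] Z) (F : C →ₗ[k] X) (G : C →ₗ[k] Y) (g : Z →ₗ[k] P) :
    g ∘ₗ conv b F G = conv (b.compr₂ g) F G := by
  simp only [conv, TensorProduct.lift_compr₂, LinearMap.comp_assoc]

lemma conv_assoc {b₁ : X →ₗ[k] Y →ₗ[k] P} {b₂ : P →ₗ[k] Z →ₗ[k] Q}
    {R : Type*} [AddCommGroup R] [Module k R]
    {b₃ : Y →ₗ[k] Z →ₗ[k] R} {b₄ : X →ₗ[k] R →ₗ[k] Q}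
    (h : ∀ x y z, b₂ (b₁ x y) z = b₄ x (b₃ y z))
    (F : C →ₗ[k] X) (G : C →ₗ[k] Y) (H : C →ₗ[k] Z) :
    conv b₂ (conv b₁ F G) H = conv b₄ F (conv b₃ G H) := by
  have h1 : TensorProduct.map (conv b₁ F G) H = TensorProduct.map (TensorProduct.lift b₁ ∘ₗ
      TensorProduct.map F G) H ∘ₗ Coalgebra.comul.rTensor C :=
    TensorProduct.ext' fun x y => by simp [conv]
  have h2 : TensorProduct.map F (conv b₃ G H) = TensorProduct.map F (TensorProduct.lift b₃ ∘ₗ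
      TensorProduct.map G H) ∘ₗ Coalgebra.comul.lTensor C :=
    TensorProduct.ext' fun x y => by simp [conv]
  have h3 : TensorProduct.lift b₂ ∘ₗ
        TensorProduct.map (TensorProduct.lift b₁ ∘ₗ TensorProduct.map F G) H =
      (TensorProduct.lift b₄ ∘ₗ TensorProduct.map F (TensorProduct.lift b₃ ∘ₗ
        TensorProduct.map G H)) ∘ₗ (TensorProduct.assoc k C C C).toLinearMap :=
    TensorProduct.ext_threefold fun x y z => by simp [h]
  rw [conv, h1, conv, h2]
  refine LinearMap.ext fun x => ?_
  have h4 := LinearMap.congr_fun h3 (Coalgebra.comul.rTensor C (Coalgebra.comul (R := k) x))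
  simp only [LinearMap.comp_apply, LinearEquiv.coe_coe, Coalgebra.coassoc_apply] at h4 ⊢
  exact h4

lemma conv_comm [Coalgebra.IsCocomm k C] {b : X →ₗ[k] Y →ₗ[k] Z} {b' : Y →ₗ[k] X →ₗ[k] Z}
    (h : ∀ x y, b x y = b' y x) (F : C →ₗ[k] X) (G : C →ₗ[k] Y) :
    conv b F G = conv b' G F := by
  have e : TensorProduct.lift b ∘ₗ TensorProduct.map F G =
      (TensorProduct.lift b' ∘ₗ TensorProduct.map G F) ∘ₗ (TensorProduct.comm k C C).toLinearMap := by
    ext x y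
    simp [h]
  rw [conv, conv, ← LinearMap.comp_assoc, e, LinearMap.comp_assoc, Coalgebra.comm_comp_comul k C,
    LinearMap.comp_assoc]

lemma conv_counit_left (b : X →ₗ[k] Y →ₗ[k] Z) (e : X) (G : C →ₗ[k] Y) :
    conv b (Coalgebra.counit.smulRight e) G = b e ∘ₗ G := by
  ext x
  let r := Coalgebra.Repr.arbitrary k x
  rw [conv_apply_repr b _ _ x r]
  conv_rhs => rw [← Coalgebra.sum_counit_smul r]
  simp

end Conv

/-- A measuring of `k`-algebras from `R` to `R'` by a coalgebra `C`:
`ψ(x)(ab) = ∑ ψ(x₁)(a) ψ(x₂)(b)` and `ψ(x)(1) = ε(x) 1`. -/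
structure IsMeasuring (k : Type*) {C R R' : Type*} [CommRing k] [AddCommGroup C] [Module k C]
    [Coalgebra k C] [Ring R] [Algebra k R] [Ring R'] [Algebra k R']
    (ψ : C →ₗ[k] R →ₗ[k] R') : Prop where
  map_mul : ∀ x a b, ψ x (a * b) = conv (LinearMap.mul k R') (ψ.flip a) (ψ.flip b) x
  map_one : ∀ x, ψ x 1 = (Coalgebra.counit x : k) • (1 : R')

/- The maps on bar complexes induced by a cocommutative measuring. -/
section Induced

variable {k C A V A' V' : Type*} [CommRing k] [AddCommGroup C] [Module k C] [Coalgebra k C]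
  [CommRing A] [Algebra k A] [CommRing V] [Algebra k V] [Algebra A V]
  [CommRing A'] [Algebra k A'] [CommRing V'] [Algebra k V'] [Algebra A' V'] [IsScalarTower k A' V']

/-- The action of `A` on an `A`-module, as a `k`-bilinear map. -/
noncomputable def smulB (k A M : Type*) [CommRing k] [CommRing A] [Algebra k A] [AddCommGroup M] [Module k M]
    [Module A M] [IsScalarTower k A M] : A →ₗ[k] M →ₗ[k] M :=
  (Algebra.lsmul k k M).toLinearMap

/-- `consMap` as a `k`-bilinear map. -/
noncomputable def consB (k A V : Type*) [CommRing k] [CommRing A] [Algebra k A] [CommRing V] [Algebra k V]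
    [Algebra A V] [IsScalarTower k A V] (n : ℕ) : V →ₗ[k] TPow A V n →ₗ[k] TPow A V (n + 1) :=
  (consMap (A := A) (V := V) n).restrictScalars₁₂ k k

/-- `x ↦ ∑ x₁(u¹) ⊗ ⋯ ⊗ xₙ(uⁿ)`, where `x(u) = Ψ x u`; it is `ε(x) 1` for `n = 0`. -/
noncomputable def psiWord (Ψ : C →ₗ[k] V →ₗ[k] V') :
    ∀ n, (Fin n → V) → (C →ₗ[k] TPow A' V' n)
  | 0, _ => Coalgebra.counit.smulRight (PiTensorProduct.tprod A' (fun i : Fin 0 => i.elim0))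
  | n + 1, u => conv (consB k A' V' n) (Ψ.flip (u 0)) (psiWord Ψ n (Fin.tail u))

/-- Auxiliary: a pair of measurings of `A` and of the `A`-algebra `V`, with
`x(a · v) = ∑ x₁(a) · x₂(v)`. It is proved below for measurings of Hopf algebroids. -/
structure SemiMeasuring (ψ : C →ₗ[k] A →ₗ[k] A') (Ψ : C →ₗ[k] V →ₗ[k] V') : Prop where
  base : IsMeasuring k ψ
  total : IsMeasuring k Ψ
  smul : ∀ a v, Ψ.flip (a • v) = conv (smulB k A' V') (ψ.flip a) (Ψ.flip v)

lemma psiWord_add (Ψ : C →ₗ[k] V →ₗ[k] V') : ∀ (n : ℕ) (u : Fin n → V) (i : Fin n) (v w : V),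
    (psiWord Ψ n (Function.update u i (v + w)) : C →ₗ[k] TPow A' V' n) =
      psiWord Ψ n (Function.update u i v) + psiWord Ψ n (Function.update u i w) := by
  intro n
  induction n with
  | zero => intro u i; exact i.elim0
  | succ n ih =>
    intro u i v w
    refine Fin.cases ?_ (fun i => ?_) i
    · simp only [psiWord, Fin.tail_update_zero, Function.update_self, map_add, conv_add_left]
    · simp only [psiWord, Fin.tail_update_succ, Function.update_of_ne (Fin.succ_ne_zero i).symm,
        ih, conv_add_right]

lemma psiWord_smul [Coalgebra.IsCocomm k C] {ψ : C →ₗ[k] A →ₗ[k] A'} {Ψ : C →ₗ[k] V →ₗ[k] V'}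
    (h : SemiMeasuring ψ Ψ) : ∀ (n : ℕ) (u : Fin n → V) (i : Fin n) (a : A),
    (psiWord Ψ n (Function.update u i (a • u i)) : C →ₗ[k] TPow A' V' n) =
      conv (smulB k A' (TPow A' V' n)) (ψ.flip a) (psiWord Ψ n u) := by
  intro n
  induction n with
  | zero => intro u i; exact i.elim0
  | succ n ih =>
    intro u i a
    refine Fin.cases ?_ (fun i => ?_) i
    · simp only [psiWord, Fin.tail_update_zero, Function.update_self, h.smul]
      exact conv_assoc (fun x y z => by simp [smulB, consB]) _ _ _
    · simp only [psiWord, Fin.tail_update_succ, Function.update_of_ne (Fin.succ_ne_zero i).symm]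
      have : Fin.tail u i = u i.succ := rfl
      rw [← this, ih]
      rw [conv_comm (b' := (consB k A' V' n).flip) (fun _ _ => rfl)]
      rw [conv_assoc (b₃ := (consB k A' V' n).flip) (b₄ := smulB k A' (TPow A' V' (n + 1)))
        (fun x y z => by simp [smulB, consB])]
      congr 1
      exact conv_comm (fun _ _ => rfl) _ _

/-- The map `a · u¹ ⊗ ⋯ ⊗ uⁿ ↦ (x ↦ ∑ x₁(a) · x₂(u¹) ⊗ ⋯ ⊗ xₙ₊₁(uⁿ))` is well defined on the tensor
power over `A`. -/
noncomputable def psiHom [Coalgebra.IsCocomm k C] {ψ : C →ₗ[k] A →ₗ[k] A'} {Ψ : C →ₗ[k] V →ₗ[k] V'}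
    (h : SemiMeasuring ψ Ψ) (n : ℕ) : TPow A V n →+ (C →ₗ[k] TPow A' V' n) :=
  PiTensorProduct.liftAddHom
    (fun x => conv (smulB k A' (TPow A' V' n)) (ψ.flip x.1) (psiWord Ψ n x.2))
    (fun r f i hf => by
      have e : f = Function.update f i ((0 : A) • f i) := by
        rw [zero_smul, ← hf, Function.update_eq_self]
      simp only
      rw [e, psiWord_smul h, map_zero, conv_zero_left, conv_zero_right])
    (fun f => by simp only [map_zero, conv_zero_left])
    (fun {inst} r f i v w => by
      obtain rfl := dec_eq inst
      simp only [psiWord_add, conv_add_right])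
    (fun r r' f => by simp only [map_add, conv_add_left])
    (fun {inst} r f i r' => by
      obtain rfl := dec_eq inst
      simp only [psiWord_smul h]
      have e : ψ.flip (r' * r) = conv (LinearMap.mul k A') (ψ.flip r') (ψ.flip r) :=
        LinearMap.ext fun x => h.base.map_mul x r' r
      rw [e, conv_comm (b' := LinearMap.mul k A') (fun x y => mul_comm x y)]
      exact (conv_assoc (fun x y z => by simp [smulB]) _ _ _).symm)


section
variable [Coalgebra.IsCocomm k C] {ψ : C →ₗ[k] A →ₗ[k] A'} {Ψ : C →ₗ[k] V →ₗ[k] V'}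

lemma psiHom_tprodCoeff (h : SemiMeasuring ψ Ψ) (n : ℕ) (r : A) (u : Fin n → V) :
    psiHom h n (PiTensorProduct.tprodCoeff A r u) =
      conv (smulB k A' (TPow A' V' n)) (ψ.flip r) (psiWord Ψ n u) := rfl

lemma psiHom_smul (h : SemiMeasuring ψ Ψ) (n : ℕ) (a : A) (z : TPow A V n) :
    psiHom h n (a • z) = conv (smulB k A' (TPow A' V' n)) (ψ.flip a) (psiHom h n z) := by
  induction z using PiTensorProduct.induction_on' with
  | tprodCoeff r u =>
    rw [PiTensorProduct.smul_tprodCoeff', psiHom_tprodCoeff, psiHom_tprodCoeff]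
    have e : ψ.flip (a • r) = conv (LinearMap.mul k A') (ψ.flip a) (ψ.flip r) :=
      LinearMap.ext fun x => h.base.map_mul x a r
    rw [e]
    exact conv_assoc (fun x y z => by simp [smulB]) _ _ _
  | add x y hx hy => rw [smul_add, map_add, hx, hy, map_add, conv_add_right]

lemma psiHom_tprod (h : SemiMeasuring ψ Ψ) (n : ℕ) (u : Fin n → V) :
    psiHom h n (PiTensorProduct.tprod A u) = psiWord Ψ n u := by
  rw [PiTensorProduct.tprod_eq_tprodCoeff_one, psiHom_tprodCoeff]
  have e : ψ.flip 1 = Coalgebra.counit.smulRight (1 : A') :=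
    LinearMap.ext fun x => h.base.map_one x
  rw [e, conv_counit_left]
  ext x
  simp [smulB]

lemma psiHom_cons (h : SemiMeasuring ψ Ψ) (n : ℕ) (v : V) (z : TPow A V n) :
    psiHom h (n + 1) (consMap n v z) = conv (consB k A' V' n) (Ψ.flip v) (psiHom h n z) := by
  induction z using PiTensorProduct.induction_on with
  | smul_tprod r u =>
    rw [map_smul, consMap_tprod, psiHom_smul, psiHom_smul, psiHom_tprod, psiHom_tprod]
    simp only [psiWord, Fin.cons_zero, Fin.tail_cons]
    rw [conv_comm (b' := (consB k A' V' n).flip) (fun _ _ => rfl),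
      conv_comm (b := consB k A' V' n) (b' := (consB k A' V' n).flip) (fun _ _ => rfl)]
    exact (conv_assoc (fun x y z => by simp [smulB, consB]) _ _ _).symm
  | add x y hx hy => rw [map_add, map_add, hx, hy, map_add, conv_add_right]

lemma tprod_eq_cons {n : ℕ} (u : Fin (n + 1) → V) :
    PiTensorProduct.tprod A u = consMap n (u 0) (PiTensorProduct.tprod A (Fin.tail u)) := by
  rw [consMap_tprod, Fin.cons_self_tail]

lemma faceFirst_cons (α : V →ₗ[A] A) (n : ℕ) (v : V) (z : TPow A V n) :
    faceFirst α n (consMap n v z) = α v • z := by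
  have : faceFirst α n ∘ₗ consMap n v = α v • LinearMap.id := by
    refine PiTensorProduct.ext (MultilinearMap.ext fun u => ?_)
    simp only [LinearMap.compMultilinearMap_apply, LinearMap.comp_apply, consMap_tprod]
    rw [faceFirst, PiTensorProduct.lift.tprod]
    simp
  exact LinearMap.congr_fun this z

lemma dTail_cons (β : V →ₗ[A] A) (v : V) (z : TPow A V 0) :
    dTail β 0 (consMap 0 v z) = -(β v • z) := by
  have : dTail β 0 ∘ₗ consMap 0 v = -(β v • LinearMap.id) := by
    refine PiTensorProduct.ext (MultilinearMap.ext fun u => ?_)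
    simp only [LinearMap.compMultilinearMap_apply, LinearMap.comp_apply, consMap_tprod, dTail,
      LinearMap.add_apply, LinearMap.smul_apply, faceLast]
    rw [PiTensorProduct.lift.tprod]
    simp
    congr 3
    exact Subsingleton.elim _ _
  exact LinearMap.congr_fun this z

lemma dTail_cons_cons' (β : V →ₗ[A] A) {n : ℕ} (u v : V) (z : TPow A V n) :
    dTail β (n + 1) (consMap (n + 1) u (consMap n v z)) =
      -consMap n (u * v) z - consMap n u (dTail β n (consMap n v z)) := by
  have : dTail β (n + 1) ∘ₗ consMap (n + 1) u ∘ₗ consMap n v =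
      -consMap n (u * v) - consMap n u ∘ₗ dTail β n ∘ₗ consMap n v := by
    refine PiTensorProduct.ext (MultilinearMap.ext fun f => ?_)
    simp only [LinearMap.compMultilinearMap_apply, LinearMap.comp_apply, consMap_tprod,
      LinearMap.sub_apply, LinearMap.neg_apply]
    exact dTail_cons_cons β u v f
  exact LinearMap.congr_fun this z

lemma psiHom_faceFirst (h : SemiMeasuring ψ Ψ) {α : V →ₗ[A] A} {α' : V' →ₗ[A'] A'}
    (hα : ∀ x v, ψ x (α v) = α' (Ψ x v)) (n : ℕ) (v : V) (z : TPow A V n) (x : C) :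
    faceFirst α' n (psiHom h (n + 1) (consMap n v z) x) =
      psiHom h n (faceFirst α n (consMap n v z)) x := by
  rw [psiHom_cons, faceFirst_cons, psiHom_smul]
  let r := Coalgebra.Repr.arbitrary k x
  rw [conv_apply_repr _ _ _ x r, conv_apply_repr _ _ _ x r, map_sum]
  refine Finset.sum_congr rfl fun i _ => ?_
  have e := hα (r.left i) v
  change faceFirst α' n (consMap n (Ψ (r.left i) v) _) = ψ (r.left i) (α v) • _
  rw [faceFirst_cons, e]

lemma cons_span {n : ℕ} {P : TPow A V (n + 1) → Prop}
    (hc : ∀ v z, P (consMap n v z)) (ha : ∀ y z, P y → P z → P (y + z))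
    (z : TPow A V (n + 1)) : P z := by
  induction z using PiTensorProduct.induction_on with
  | smul_tprod r u => rw [tprod_eq_cons, ← map_smul]; exact hc _ _
  | add y z hy hz => exact ha _ _ hy hz

lemma psiHom_dTail (h : SemiMeasuring ψ Ψ) {β : V →ₗ[A] A} {β' : V' →ₗ[A'] A'}
    (hβ : ∀ x v, ψ x (β v) = β' (Ψ x v)) : ∀ (n : ℕ) (z : TPow A V (n + 1)) (x : C),
    dTail β' n (psiHom h (n + 1) z x) = psiHom h n (dTail β n z) x := by
  intro n
  induction n with
  | zero =>
    intro z x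
    induction z using cons_span with
    | hc v z =>
      rw [psiHom_cons, dTail_cons, map_neg, psiHom_smul, LinearMap.neg_apply]
      let r := Coalgebra.Repr.arbitrary k x
      rw [conv_apply_repr _ _ _ x r, conv_apply_repr _ _ _ x r, map_sum, ← Finset.sum_neg_distrib]
      refine Finset.sum_congr rfl fun i _ => ?_
      have e := hβ (r.left i) v
      change dTail β' 0 (consMap 0 (Ψ (r.left i) v) _) = -(ψ (r.left i) (β v) • _)
      rw [dTail_cons, e]
    | ha y z hy hz => simp only [map_add, LinearMap.add_apply, hy, hz]
  | succ n ih =>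
    intro z x
    induction z using cons_span with
    | ha y z hy hz => simp only [map_add, LinearMap.add_apply, hy, hz]
    | hc u z =>
      induction z using cons_span with
      | ha y z hy hz => simp only [map_add, LinearMap.add_apply, hy, hz]
      | hc v z =>
        have step : ∀ (y : C) (w : V'), dTail β' (n + 1) (consMap (n + 1) w
            (psiHom h (n + 1) (consMap n v z) y)) =
            - conv (((LinearMap.mul k V').compr₂ (consB k A' V' n)) w)
                (Ψ.flip v) (psiHom h n z) y -
              consMap n w (psiHom h n (dTail β n (consMap n v z)) y) := by
          intro y w
          rw [← ih, psiHom_cons]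
          let r := Coalgebra.Repr.arbitrary k y
          rw [conv_apply_repr _ _ _ y r, conv_apply_repr _ _ _ y r]
          simp only [map_sum]
          rw [← Finset.sum_neg_distrib, ← Finset.sum_sub_distrib]
          refine Finset.sum_congr rfl fun i _ => ?_
          exact dTail_cons_cons' β' w (Ψ (r.left i) v) (psiHom h n z (r.right i))
        have em : Ψ.flip (u * v) = conv (LinearMap.mul k V') (Ψ.flip u) (Ψ.flip v) :=
          LinearMap.ext fun x => h.total.map_mul x u v
        rw [psiHom_cons, dTail_cons_cons', map_sub, map_neg,
          psiHom_cons h n (u * v) z, psiHom_cons h n u (dTail β n (consMap n v z)), em]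
        let m := LinearMap.mul k V'
        let c := consB k A' V' n
        let t := TensorProduct.mk k V' (TPow A' V' n)
        let b : V' →ₗ[k] V' ⊗[k] TPow A' V' n →ₗ[k] TPow A' V' (n + 1) :=
          (TensorProduct.uncurry (.id k) V' (TPow A' V' n) (TPow A' V' (n + 1))) ∘ₗ m.compr₂ c
        have e1 := conv_assoc (b₁ := m) (b₂ := c) (b₃ := t) (b₄ := b)
          (fun x y z => by simp [b, t, m]) (Ψ.flip u) (Ψ.flip v) (psiHom h n z)
        have e2 : ∀ (w : V') (y : C), conv (m.compr₂ c w) (Ψ.flip v) (psiHom h n z) y =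
            b w (conv t (Ψ.flip v) (psiHom h n z) y) := by
          intro w y
          let r := Coalgebra.Repr.arbitrary k y
          rw [conv_apply_repr _ _ _ y r, conv_apply_repr _ _ _ y r, map_sum]
          exact Finset.sum_congr rfl fun i _ => by simp [b, t]
        rw [e1]
        let r := Coalgebra.Repr.arbitrary k x
        rw [LinearMap.sub_apply, LinearMap.neg_apply, conv_apply_repr _ _ _ x r,
          conv_apply_repr b _ _ x r, conv_apply_repr _ _ _ x r, map_sum,
          ← Finset.sum_neg_distrib, ← Finset.sum_sub_distrib]
        refine Finset.sum_congr rfl fun i _ => ?_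
        rw [← e2]
        exact step (r.right i) (Ψ (r.left i) u)

lemma bar_d_psiHom (h : SemiMeasuring ψ Ψ) {α β : V →ₗ[A] A} {α' β' : V' →ₗ[A'] A'}
    (hα : ∀ x v, ψ x (α v) = α' (Ψ x v)) (hβ : ∀ x v, ψ x (β v) = β' (Ψ x v)) (n : ℕ)
    (z : TPow A V (n + 1)) (x : C) :
    bar_d α' β' n (psiHom h (n + 1) z x) = psiHom h n (bar_d α β n z) x := by
  have e : ∀ (α β : V →ₗ[A] A), bar_d α β n = faceFirst α n + dTail β n := fun α β => by
    rw [bar_d, dTail, add_assoc]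
  have e' : bar_d α' β' n = faceFirst α' n + dTail β' n := by
    rw [bar_d, dTail, add_assoc]
  rw [e, e']
  simp only [LinearMap.add_apply, map_add]
  rw [psiHom_dTail h hβ]
  congr 1
  induction z using cons_span with
  | hc v z => exact psiHom_faceFirst h hα n v z x
  | ha y z hy hz => simp only [map_add, LinearMap.add_apply, hy, hz]

/-- The map of complexes `x(u¹ ⊗ ⋯ ⊗ uⁿ) = ∑ x₁(u¹) ⊗ ⋯ ⊗ xₙ(uⁿ)` induced by `x` in `C`, with
`x(a) = ψ x a` for `n = 0`. -/
noncomputable def psiMap (h : SemiMeasuring ψ Ψ) (n : ℕ) :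
    C →ₗ[k] TPow A V n →ₗ[k] TPow A' V' n :=
  LinearMap.flip
    { toFun := psiHom h n
      map_add' := map_add _
      map_smul' := fun c z => by
        rw [← algebraMap_smul A c z, psiHom_smul]
        have e : ψ.flip (algebraMap k A c) = Coalgebra.counit.smulRight (algebraMap k A' c) := by
          refine LinearMap.ext fun x => ?_
          rw [Algebra.algebraMap_eq_smul_one, map_smul, LinearMap.smul_apply,
            LinearMap.flip_apply, h.base.map_one, LinearMap.smulRight_apply,
            Algebra.algebraMap_eq_smul_one, smul_comm]
        rw [e, conv_counit_left]
        exact LinearMap.ext fun x => algebraMap_smul A' c _ }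

lemma psiMap_bar (h : SemiMeasuring ψ Ψ) {α β : V →ₗ[A] A} {α' β' : V' →ₗ[A'] A'}
    (hα : ∀ x v, ψ x (α v) = α' (Ψ x v)) (hβ : ∀ x v, ψ x (β v) = β' (Ψ x v)) (n : ℕ)
    (x : C) (z : TPow A V (n + 1)) :
    barDk k α' β' n (psiMap h (n + 1) x z) = psiMap h n x (barDk k α β n z) :=
  bar_d_psiHom h hα hβ n z x

lemma psiMap_mem_cycles (h : SemiMeasuring ψ Ψ) {α β : V →ₗ[A] A} {α' β' : V' →ₗ[A'] A'}
    (hα : ∀ x v, ψ x (α v) = α' (Ψ x v)) (hβ : ∀ x v, ψ x (β v) = β' (Ψ x v)) (n : ℕ)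
    (x : C) {z : TPow A V n} (hz : z ∈ cycles k α β n) :
    psiMap h n x z ∈ cycles k α' β' n := by
  cases n with
  | zero => exact Submodule.mem_top
  | succ n =>
    have hz' : barDk k α β n z = 0 := hz
    change barDk k α' β' n _ = 0
    rw [psiMap_bar h hα hβ, hz', map_zero]

/-- The map induced on homology in degree `n`: the class of `z` goes to the class of `x(z)`. -/
noncomputable def psiHH (h : SemiMeasuring ψ Ψ) {α β : V →ₗ[A] A} {α' β' : V' →ₗ[A'] A'}
    (hα : ∀ x v, ψ x (α v) = α' (Ψ x v)) (hβ : ∀ x v, ψ x (β v) = β' (Ψ x v)) (n : ℕ) :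
    C →ₗ[k] BarHH k α β n →ₗ[k] BarHH k α' β' n :=
  LinearMap.flip (Submodule.liftQ _
    (LinearMap.mk₂ k
      (fun (z : cycles k α β n) x => BarHH.mk n ⟨psiMap h n x z.1, psiMap_mem_cycles h hα hβ n x z.2⟩)
      (fun z z' x => by
        rw [← map_add]; exact congrArg _ (Subtype.ext (map_add (psiMap h n x) z.1 z'.1)))
      (fun c z x => by
        rw [← map_smul]; exact congrArg _ (Subtype.ext (map_smul (psiMap h n x) c z.1)))
      (fun z x x' => by
        rw [← map_add]; exact congrArg _ (Subtype.ext (LinearMap.map_add₂ (psiMap h n) x x' z.1)))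
      (fun c z x => by
        rw [← map_smul]; exact congrArg _ (Subtype.ext (LinearMap.map_smul₂ (psiMap h n) c x z.1))))
    (by
      rintro z ⟨w, hw⟩
      refine LinearMap.ext fun x => ?_
      refine (Submodule.Quotient.mk_eq_zero _).2 ⟨psiMap h (n + 1) x w, ?_⟩
      have hw' : barDk k α β n w = z.1 := hw
      rw [psiMap_bar h hα hβ, hw']
      rfl))

lemma psiHH_mk (h : SemiMeasuring ψ Ψ) {α β : V →ₗ[A] A} {α' β' : V' →ₗ[A'] A'}
    (hα : ∀ x v, ψ x (α v) = α' (Ψ x v)) (hβ : ∀ x v, ψ x (β v) = β' (Ψ x v)) (n : ℕ)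
    (x : C) (z : cycles k α β n) :
    psiHH h hα hβ n x (BarHH.mk n z) =
      BarHH.mk n ⟨psiMap h n x z.1, psiMap_mem_cycles h hα hβ n x z.2⟩ := rfl

/-- The map induced on the sum of all homology groups. -/
noncomputable def psiTotal (h : SemiMeasuring ψ Ψ) {α β : V →ₗ[A] A} {α' β' : V' →ₗ[A'] A'}
    (hα : ∀ x v, ψ x (α v) = α' (Ψ x v)) (hβ : ∀ x v, ψ x (β v) = β' (Ψ x v)) :
    C →ₗ[k] (⨁ n, BarHH k α β n) →ₗ[k] ⨁ n, BarHH k α' β' n :=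
  LinearMap.flip (DirectSum.toModule k ℕ _ fun n =>
    LinearMap.flip ((psiHH h hα hβ n).compr₂ (DirectSum.lof k ℕ (BarHH k α' β') n)))
end
end Induced


/- Commutative Hopf algebroids, their measurings and their Hochschild homology. -/
section Hopf

/-- A copy of `U`, regarded as an `A`-algebra through `f : A → U`: the scalar `a` acts as
multiplication by `f a`. -/
def Along {k A U : Type*} [CommSemiring k] [Semiring A] [Semiring U] [Algebra k A] [Algebra k U]
    (_f : A →ₐ[k] U) : Type _ := U

section AlongInst
variable {k A U : Type*} [CommRing k] [CommRing A] [CommRing U] [Algebra k A] [Algebra k U]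

instance (f : A →ₐ[k] U) : CommRing (Along f) := inferInstanceAs (CommRing U)

instance (f : A →ₐ[k] U) : Algebra k (Along f) := inferInstanceAs (Algebra k U)

noncomputable instance (f : A →ₐ[k] U) : Algebra A (Along f) :=
  RingHom.toAlgebra (S := Along f) (f : A →+* U)

instance (f : A →ₐ[k] U) : IsScalarTower k A (Along f) :=
  IsScalarTower.of_algebraMap_eq fun c => (f.commutes c).symm

/-- The identity map of `U`, onto the copy of `U` regarded as an `A`-algebra through `f`. -/
def Along.of (f : A →ₐ[k] U) : U ≃ₐ[k] Along f := AlgEquiv.refl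

lemma Along.smul_of (f : A →ₐ[k] U) (a : A) (u : U) :
    a • Along.of f u = Along.of f (f a * u) := rfl

/-- The tensor product `U ⊗_A U` of `(A, A)`-bimodules, for the bimodule structure
`a · u · b = s(a) t(b) u`. It is the quotient of `U ⊗ U` by `t(a)u ⊗ v = u ⊗ s(a)v`, and it is an
algebra with the factorwise product because `U` and `A` are commutative. -/
abbrev BalTensor (s t : A →ₐ[k] U) : Type _ := Along t ⊗[A] Along s

/-- The pure tensor `u ⊗ v` in `U ⊗_A U`, as a bilinear map. -/
noncomputable def balMk (s t : A →ₐ[k] U) : U →ₗ[k] U →ₗ[k] BalTensor s t :=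
  ((TensorProduct.mk A (Along t) (Along s)).restrictScalars₁₂ k k).compl₁₂
    (Along.of t).toLinearMap (Along.of s).toLinearMap

/-- The left `A`-module structure of `U ⊗_A U`: `a · (v ⊗ w) = s(a)v ⊗ w`, as an algebra map. -/
noncomputable def balLeft (s t : A →ₐ[k] U) : A →ₐ[k] BalTensor s t :=
  ((Algebra.TensorProduct.includeLeft :
      Along t →ₐ[A] BalTensor s t).restrictScalars k).comp
    ((Along.of t : U →ₐ[k] Along t).comp s)

/-- The threefold tensor product `U ⊗_A (U ⊗_A U)`, a quotient by
`t(a)u ⊗ (v ⊗ w) = u ⊗ (s(a)v ⊗ w)`. -/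
abbrev BalTensor₃ (s t : A →ₐ[k] U) : Type _ := Along t ⊗[A] Along (balLeft s t)

/-- The tensor `u ⊗ z` in `U ⊗_A (U ⊗_A U)`. -/
noncomputable def balMk₃ (s t : A →ₐ[k] U) (u : U) (z : BalTensor s t) : BalTensor₃ s t :=
  Along.of t u ⊗ₜ[A] Along.of (balLeft s t) z

end AlongInst

/-- A commutative Hopf algebroid over `k` (with involutive antipode): a left bialgebroid
`(U, A, s, t, Δ, ε)` in which `U` and `A` are commutative, with an antipode `S`. As `U` is
commutative, the images of `s` and `t` commute, `Δ` takes its values in the Takeuchi product (which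
is all of `U ⊗_A U`), and an anti-automorphism of `U` is an automorphism.

Identities in Sweedler notation are stated for every way of writing `Δ u` as a sum of pure
tensors `∑ i, p i ⊗ q i`. -/
structure CommHopfAlgebroid (k A U : Type*) [CommRing k] [CommRing A] [CommRing U] [Algebra k A]
    [Algebra k U] where
  /-- The source map. -/
  s : A →ₐ[k] U
  /-- The target map. -/
  t : A →ₐ[k] U
  /-- The coproduct, a morphism of unital algebras. -/
  Δ : U →ₐ[k] BalTensor s t
  /-- The counit. -/
  ε : U →ₗ[k] A
  /-- The antipode. -/
  S : U →ₐ[k] U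
  /-- `Δ (a · u · b) = a · Δ u · b` -/
  Δ_bimodule : ∀ (a b : A) (u : U), Δ (s a * t b * u) = balMk s t (s a) (t b) * Δ u
  /-- `ε (a · u · b) = a ε(u) b` -/
  ε_bimodule : ∀ (a b : A) (u : U), ε (s a * t b * u) = a * ε u * b
  /-- Coassociativity: `(Δ ⊗ id) (Δ u) = (id ⊗ Δ) (Δ u)`. -/
  coassoc : ∀ (u : U) (n : ℕ) (p q : Fin n → U) (m : Fin n → ℕ) (v w : ∀ i, Fin (m i) → U),
    Δ u = ∑ i, balMk s t (p i) (q i) → (∀ i, Δ (p i) = ∑ j, balMk s t (v i j) (w i j)) →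
    ∑ i, ∑ j, balMk₃ s t (v i j) (balMk s t (w i j) (q i)) = ∑ i, balMk₃ s t (p i) (Δ (q i))
  /-- `ε(u₁) · u₂ = u` -/
  counit_left : ∀ (u : U) (n : ℕ) (p q : Fin n → U), Δ u = ∑ i, balMk s t (p i) (q i) →
    ∑ i, s (ε (p i)) * q i = u
  /-- `u₁ · ε(u₂) = u` -/
  counit_right : ∀ (u : U) (n : ℕ) (p q : Fin n → U), Δ u = ∑ i, balMk s t (p i) (q i) →
    ∑ i, t (ε (q i)) * p i = u
  /-- `ε(u s(ε(v))) = ε(uv)` -/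
  ε_mul_s : ∀ u v, ε (u * s (ε v)) = ε (u * v)
  /-- `ε(u t(ε(v))) = ε(uv)` -/
  ε_mul_t : ∀ u v, ε (u * t (ε v)) = ε (u * v)
  /-- The antipode is involutive. -/
  S_invol : ∀ u, S (S u) = u
  /-- `S ∘ t = s` -/
  S_t : ∀ a, S (t a) = s a
  /-- `S(u₁)₁ u₂ ⊗ S(u₁)₂ = 1 ⊗ S(u)` -/
  S_left : ∀ (u : U) (n : ℕ) (p q : Fin n → U), Δ u = ∑ i, balMk s t (p i) (q i) →
    ∑ i, Δ (S (p i)) * balMk s t (q i) 1 = balMk s t 1 (S u)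
  /-- `S(u₂)₁ ⊗ S(u₂)₂ u₁ = S(u) ⊗ 1` -/
  S_right : ∀ (u : U) (n : ℕ) (p q : Fin n → U), Δ u = ∑ i, balMk s t (p i) (q i) →
    ∑ i, Δ (S (q i)) * balMk s t 1 (p i) = balMk s t (S u) 1

section HopfMeas
variable {k C A U A' U' : Type*} [CommRing k] [AddCommGroup C] [Module k C] [Coalgebra k C]
  [CommRing A] [CommRing U] [Algebra k A] [Algebra k U]
  [CommRing A'] [CommRing U'] [Algebra k A'] [Algebra k U']

/-- A measuring `(Ψ, ψ)` of commutative Hopf algebroids by a coalgebra `C`: a pair of measurings of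
algebras that are compatible with source, target, antipode, counit and coproduct. The last condition
says that `Δ' (x(u)) = x(Δ u)`, where `x(p ⊗ q) = x₁(p) ⊗ x₂(q)` for `x` in `C`. -/
structure IsHopfMeasuring (H : CommHopfAlgebroid k A U) (H' : CommHopfAlgebroid k A' U')
    (Ψ : C →ₗ[k] U →ₗ[k] U') (ψ : C →ₗ[k] A →ₗ[k] A') : Prop where
  total : IsMeasuring k Ψ
  base : IsMeasuring k ψ
  source : ∀ x a, Ψ x (H.s a) = H'.s (ψ x a)
  target : ∀ x a, Ψ x (H.t a) = H'.t (ψ x a)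
  antipode : ∀ x u, Ψ x (H.S u) = H'.S (Ψ x u)
  counit : ∀ x u, ψ x (H.ε u) = H'.ε (Ψ x u)
  coproduct : ∀ (x : C) (u : U) (n : ℕ) (p q : Fin n → U),
    H.Δ u = ∑ i, balMk H.s H.t (p i) (q i) →
    H'.Δ (Ψ x u) = ∑ i, conv (balMk H'.s H'.t) (Ψ.flip (p i)) (Ψ.flip (q i)) x

namespace CommHopfAlgebroid
variable (H : CommHopfAlgebroid k A U)

/-- The right counit `ε_R = ε ∘ S`, linear over `A` for the module structure `a · u = t(a) u`. -/
noncomputable def εR : Along H.t →ₗ[A] A where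
  toFun u := H.ε (H.S ((Along.of H.t).symm u))
  map_add' u v := by simp
  map_smul' a u := by
    have h := H.ε_bimodule a 1 (H.S ((Along.of H.t).symm u))
    rw [map_one, mul_one, mul_one] at h
    rw [RingHom.id_apply, smul_eq_mul, ← h, ← H.S_t, ← map_mul]
    rfl

/-- The map `ε_R ∘ S`, linear over `A` for the module structure `a · u = t(a) u`. -/
noncomputable def εRS : Along H.t →ₗ[A] A where
  toFun u := H.ε (H.S (H.S ((Along.of H.t).symm u)))
  map_add' u v := by simp
  map_smul' a u := by
    have h := H.ε_bimodule 1 a ((Along.of H.t).symm u)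
    rw [map_one, one_mul, one_mul, mul_comm (H.ε _)] at h
    rw [RingHom.id_apply, smul_eq_mul, H.S_invol, H.S_invol, ← h]
    rfl

/-- The Hochschild homology `HH_n` of a commutative Hopf algebroid: the homology of the complex
`C_n = U ⊗_A ⋯ ⊗_A U`, with differential `∑ (-1)^i d_i`. -/
abbrev HHn (n : ℕ) : Type _ := BarHH k H.εR H.εRS n

/-- The Hochschild homology `⨁ n, HH_n`, with the algebra structure given by shuffle products. -/
abbrev HH : Type _ := ⨁ n, H.HHn n

end CommHopfAlgebroid

variable {H : CommHopfAlgebroid k A U} {H' : CommHopfAlgebroid k A' U'}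
  {Ψ : C →ₗ[k] U →ₗ[k] U'} {ψ : C →ₗ[k] A →ₗ[k] A'}

/-- `Ψ x`, as a map between the copies of `U` and `U'` that are `A`-algebras through `t`. -/
noncomputable def alongMap (H : CommHopfAlgebroid k A U) (H' : CommHopfAlgebroid k A' U')
    (Ψ : C →ₗ[k] U →ₗ[k] U') : C →ₗ[k] Along H.t →ₗ[k] Along H'.t :=
  (Ψ.compl₂ (Along.of H.t).symm.toLinearMap).compr₂ (Along.of H'.t).toLinearMap

lemma IsHopfMeasuring.semi (h : IsHopfMeasuring H H' Ψ ψ) :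
    SemiMeasuring ψ (alongMap H H' Ψ) where
  base := h.base
  total := ⟨h.total.map_mul, h.total.map_one⟩
  smul a v := by
    refine LinearMap.ext fun x => ?_
    refine (h.total.map_mul x (H.t a) v).trans ?_
    let r := Coalgebra.Repr.arbitrary k x
    rw [conv_apply_repr _ _ _ x r, conv_apply_repr _ _ _ x r]
    refine Finset.sum_congr rfl fun i _ => ?_
    exact congrArg (· * Ψ (r.right i) v) (h.target (r.left i) a)

lemma IsHopfMeasuring.map_εR (h : IsHopfMeasuring H H' Ψ ψ) (x : C) (v : Along H.t) :
    ψ x (H.εR v) = H'.εR (alongMap H H' Ψ x v) :=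
  (h.counit x _).trans (congrArg H'.ε (h.antipode x _))

lemma IsHopfMeasuring.map_εRS (h : IsHopfMeasuring H H' Ψ ψ) (x : C) (v : Along H.t) :
    ψ x (H.εRS v) = H'.εRS (alongMap H H' Ψ x v) :=
  (h.counit x _).trans (congrArg H'.ε ((h.antipode x _).trans (congrArg H'.S (h.antipode x _))))

/-- The map `C → Hom(HH_•(U), HH_•(U'))` induced by a measuring `(Ψ, ψ)`: in degree `n`, the class
of a cycle `z` goes to the class of `x(z)`, where
`x(u¹ ⊗ ⋯ ⊗ uⁿ) = x₁(u¹) ⊗ ⋯ ⊗ xₙ(uⁿ)`, and `x(a) = ψ x a` in degree `0`. -/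
noncomputable def hochMap [Coalgebra.IsCocomm k C] (h : IsHopfMeasuring H H' Ψ ψ) :
    C →ₗ[k] H.HH →ₗ[k] H'.HH :=
  psiTotal h.semi h.map_εR h.map_εRS

end HopfMeas
end Hopf

end HopfMeasuring

/-! A measuring from $R$ to $R'$ by $C$ is the same as an algebra map from $R$ to
$\mathrm{Hom}_k(C,R')$ with the convolution product. So each chain $z$ is sent to the function
$x\mapsto x(z)$ on $C$, and the claim becomes that shuffle products go to convolutions along the
shuffle product of the target.

On pure tensors the reason is cocommutativity. A shuffle only permutes tensor factors, and the
iterated coproduct $x_{(1)}\otimes\cdots\otimes x_{(n)}$ is invariant under permutations. Letting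
$x$ act factor by factor therefore commutes with every shuffle, and coassociativity regroups the
first $p$ and the last $q$ legs into $x_{(1)}$ and $x_{(2)}$.

No sum over permutations is handled here. The signed shuffle product is determined by the recursion
`shT_L_L` together with its unit: the first letter of a shuffle of two words comes from one word or
from the other. The induced map has a matching recursion, `psiTot_L`: the first leg acts on the
first letter and the other leg on the tail. `conv_shuffle_rule` shows that the shuffle recursion
survives convolution, and a double induction over words gives `psiTot_shT_word`.

The induced map is not linear over $A$: a scalar $a$ is itself acted on, by `psiTot_smul`. The
passage from words to all chains in `psiTot_shT` therefore carries scalars along explicitly. On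
homology, the product and the induced map are both computed on cycles, so the identity between
chains descends at once. The unit axiom holds because in degree $0$ the empty tensor is sent to
$\epsilon_C(x)$ times itself. -/

namespace HopfMeasuring

/-! ### Convolution and the shuffle recursion. -/

section ConvComp
variable {k C : Type*} [CommRing k] [AddCommGroup C] [Module k C] [Coalgebra k C]
variable {X Y Z X' Y' : Type*} [AddCommGroup X] [Module k X] [AddCommGroup Y] [Module k Y]
  [AddCommGroup Z] [Module k Z] [AddCommGroup X'] [Module k X'] [AddCommGroup Y'] [Module k Y']

/-- Lets linear maps move between the convolved functions and the bilinear map. `conv_shuffle_rule`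
uses it to absorb the sign operator and the attaching of a letter. -/
lemma conv_comp (b : X →ₗ[k] Y →ₗ[k] Z) (f : X' →ₗ[k] X) (g : Y' →ₗ[k] Y)
    (F : C →ₗ[k] X') (G : C →ₗ[k] Y') :
    conv b (f ∘ₗ F) (g ∘ₗ G) = conv (b.compl₁₂ f g) F G := by
  ext x
  let r := Coalgebra.Repr.arbitrary k x
  simp [conv_apply_repr _ _ _ x r]

lemma conv_add_bilin (b b' : X →ₗ[k] Y →ₗ[k] Z) (F : C →ₗ[k] X) (G : C →ₗ[k] Y) :
    conv (b + b') F G = conv b F G + conv b' F G := by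
  ext x
  let r := Coalgebra.Repr.arbitrary k x
  simp [conv_apply_repr _ _ _ x r, Finset.sum_add_distrib]

/-- If `b (l a x) (l c y) = l a (b x (l c y)) + l c (b (j (l a x)) y)`, the same rule holds for
convolutions. -/
lemma conv_shuffle_rule [Coalgebra.IsCocomm k C] (b : Y →ₗ[k] Y →ₗ[k] Y) (l : X →ₗ[k] Y →ₗ[k] Y)
    (j : Y →ₗ[k] Y)
    (h : ∀ a c x y, b (l a x) (l c y) = l a (b x (l c y)) + l c (b (j (l a x)) y))
    (F G : C →ₗ[k] X) (P Q : C →ₗ[k] Y) :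
    conv b (conv l F P) (conv l G Q) =
      conv l F (conv b P (conv l G Q)) + conv l G (conv b (j ∘ₗ conv l F P) Q) := by
  -- A letter and its tail are kept together as one value in $X\otimes Y$ and multiplied out only by
  -- `m`. A fourfold convolution then becomes a convolution of two functions, to which `conv_assoc`
  -- and `conv_comm` apply.
  let t := TensorProduct.mk k X Y
  let m := TensorProduct.lift l
  have hl : ∀ (F : C →ₗ[k] X) (P : C →ₗ[k] Y), conv l F P = m ∘ₗ conv t F P := fun F P => by
    rw [comp_conv]; rfl
  -- The two terms of the recursion, with values `l a (b x (m z))` at $(a\otimes x,z)$ and `l c (b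
  -- (j (m z)) y)` at $(c\otimes y,z)$. In the second, the pair $c\otimes y$ is the first argument
  -- because $c$ becomes the leading letter.
  let b₁ : X ⊗[k] Y →ₗ[k] X ⊗[k] Y →ₗ[k] Y := TensorProduct.lift <|
    LinearMap.mk₂ k (fun a x => l a ∘ₗ b x ∘ₗ m) (fun _ _ _ => by ext; simp)
      (fun _ _ _ => by ext; simp) (fun _ _ _ => by ext; simp) (fun _ _ _ => by ext; simp)
  let b₂ : X ⊗[k] Y →ₗ[k] X ⊗[k] Y →ₗ[k] Y := TensorProduct.lift <|
    LinearMap.mk₂ k (fun c y => l c ∘ₗ b.flip y ∘ₗ j ∘ₗ m) (fun _ _ _ => by ext; simp)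
      (fun _ _ _ => by ext; simp) (fun _ _ _ => by ext; simp) (fun _ _ _ => by ext; simp)
  have hb : b.compl₁₂ m m = b₁ + b₂.flip := by
    ext a x c y
    simpa [b₁, b₂, m] using h a c x y
  -- The legs already stand in the right order, so coassociativity suffices.
  have h₁ : conv b₁ (conv t F P) (conv t G Q) = conv l F (conv b P (conv l G Q)) := by
    rw [hl G Q, conv_assoc (b₃ := b.compl₂ m) (b₄ := l) (fun a x z => by simp [b₁, t])]
    congr 1
    exact (conv_comp b LinearMap.id m P _).symm
  -- Here the letter of the second factor overtakes the whole first factor. Cocommutativity is used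
  -- twice: to bring $c\otimes y$ to the front, and, once $c$ is split off, to put $y$ back behind
  -- the first factor.
  have h₂ : conv b₂.flip (conv t F P) (conv t G Q) =
      conv l G (conv b (j ∘ₗ conv l F P) Q) := by
    rw [conv_comm (b' := b₂) (fun _ _ => rfl), hl F P,
      conv_assoc (b₃ := b.flip.compl₂ (j ∘ₗ m)) (b₄ := l) (fun c y z => by simp [b₂, t])]
    congr 1
    rw [conv_comm (b := b) (b' := b.flip) (fun _ _ => rfl)]
    exact (conv_comp b.flip LinearMap.id (j ∘ₗ m) Q _).symm
  rw [hl F P, hl G Q, conv_comp, hb, conv_add_bilin, h₁, h₂, hl F P, hl G Q]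

end ConvComp

/-! ### The induced map on the sum of all tensor powers. -/

section TotInduced
variable {k C A V A' V' : Type*} [CommRing k] [AddCommGroup C] [Module k C] [Coalgebra k C]
  [CommRing A] [Algebra k A] [CommRing V] [Algebra k V] [Algebra A V]
  [CommRing A'] [Algebra k A'] [CommRing V'] [Algebra k V'] [Algebra A' V'] [IsScalarTower k A' V']

lemma L_add (u v : V) : L A (u + v) = L A u + L A v := tot_ext fun l => by
  rw [LinearMap.add_apply, word]; simp only [L_lof, map_add, LinearMap.add_apply]

lemma L_smul (a : A) (u : V) : L A (a • u) = a • L A u := tot_ext fun l => by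
  rw [LinearMap.smul_apply, word]; simp only [L_lof, map_smul, LinearMap.smul_apply]

variable (k A V) in
/-- The operation of putting a factor in front, as a `k`-bilinear map. -/
noncomputable def consTot [IsScalarTower k A V] : V →ₗ[k] Tot A V →ₗ[k] Tot A V :=
  LinearMap.restrictScalars₁₂ k k (IsLinearMap.mk' (L A : V → Tot A V →ₗ[A] Tot A V) ⟨L_add, L_smul⟩)

lemma consTot_apply [IsScalarTower k A V] (u : V) (x : Tot A V) : consTot k A V u x = L A u x := rfl

variable (k A V) in
/-- The shuffle product, as a `k`-bilinear map. -/
noncomputable def shTot : Tot A V →ₗ[k] Tot A V →ₗ[k] Tot A V := (shT A V).restrictScalars₁₂ k k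

variable [Coalgebra.IsCocomm k C] {ψ : C →ₗ[k] A →ₗ[k] A'} {Ψ : C →ₗ[k] V →ₗ[k] V'}

/-- The map `C → Hom(Tot, Tot')` assembled from `psiMap`, with its arguments exchanged. -/
noncomputable def psiTot (h : SemiMeasuring ψ Ψ) : Tot A V →ₗ[k] C →ₗ[k] Tot A' V' :=
  DirectSum.toModule k ℕ _ fun n =>
    LinearMap.flip ((psiMap h n).compr₂ (DirectSum.lof k ℕ (TPow A' V') n))

lemma psiTot_lof (h : SemiMeasuring ψ Ψ) (n : ℕ) (z : TPow A V n) (x : C) :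
    psiTot h (DirectSum.lof A ℕ (TPow A V) n z) x =
      DirectSum.lof A' ℕ (TPow A' V') n (psiHom h n z x) := by
  -- The inclusions of a summand over `A` and over `k` are the same function. Only the second fits
  -- `psiTot`, which is linear over `k` but in general not over `A`.
  change psiTot h (DirectSum.lof k ℕ (TPow A V) n z) x = _
  rw [psiTot, DirectSum.toModule_lof]
  rfl

/-- The empty word is the unit for shuffles and the counit is the unit for convolution. This is thus
the unit axiom on chains, and the base case of the induction on words. -/
lemma psiTot_word_nil (h : SemiMeasuring ψ Ψ) :
    psiTot h (word []) = Coalgebra.counit.smulRight (word [] : Tot A' V') := by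
  ext1 x
  -- `lof_one` serves only to write the empty word as an element of degree $0$. That element does
  -- not depend on the two functionals, so zero is as good as any.
  rw [word, psiTot_lof, psiHom_tprod, LinearMap.smulRight_apply, ← lof_one (k := k) (α := 0) (β := 0)]
  exact map_smul (DirectSum.lof k ℕ (TPow A' V') 0) (Coalgebra.counit x) (cyclesOne k 0 0).1

lemma tot_induction {P : Tot A V → Prop} (h0 : P 0) (h : ∀ n z, P (DirectSum.lof A ℕ (TPow A V) n z))
    (ha : ∀ x y, P x → P y → P (x + y)) (x : Tot A V) : P x :=
  DirectSum.induction_on x h0 h ha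

/-- The substitute for linearity over $A$: one leg of the coproduct goes to the scalar. -/
lemma psiTot_smul (h : SemiMeasuring ψ Ψ) (a : A) (x : Tot A V) :
    psiTot h (a • x) = conv (smulB k A' (Tot A' V')) (ψ.flip a) (psiTot h x) := by
  induction x using tot_induction with
  | h0 => rw [smul_zero, map_zero, conv_zero_right]
  | ha x y hx hy => rw [smul_add, map_add, hx, hy, map_add, conv_add_right]
  | h n z =>
    ext1 x
    let r := Coalgebra.Repr.arbitrary k x
    rw [← map_smul, psiTot_lof, psiHom_smul, conv_apply_repr _ _ _ x r, conv_apply_repr _ _ _ x r,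
      map_sum]
    refine Finset.sum_congr rfl fun i _ => ?_
    rw [psiTot_lof]
    exact map_smul (DirectSum.lof A' ℕ (TPow A' V') n) (ψ (r.left i) a) _

/-- The recursion for the induced map, to be matched with the recursion for shuffles. -/
lemma psiTot_L (h : SemiMeasuring ψ Ψ) (u : V) (x : Tot A V) :
    psiTot h (L A u x) = conv (consTot k A' V') (Ψ.flip u) (psiTot h x) := by
  induction x using tot_induction with
  | h0 => rw [map_zero, map_zero, conv_zero_right]
  | ha x y hx hy => rw [map_add, map_add, hx, hy, map_add, conv_add_right]
  | h n z =>
    ext1 x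
    let r := Coalgebra.Repr.arbitrary k x
    rw [L_lof, psiTot_lof, psiHom_cons, conv_apply_repr _ _ _ x r, conv_apply_repr _ _ _ x r,
      map_sum]
    refine Finset.sum_congr rfl fun i _ => ?_
    rw [psiTot_lof, consTot_apply, L_lof]
    rfl

lemma psiTot_J (h : SemiMeasuring ψ Ψ) (x : Tot A V) :
    psiTot h (J A V x) = (J A' V').restrictScalars k ∘ₗ psiTot h x := by
  induction x using tot_induction with
  | h0 => rw [map_zero, map_zero, LinearMap.comp_zero]
  | ha x y hx hy => rw [map_add, map_add, hx, hy, map_add, LinearMap.comp_add]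
  | h n z =>
    ext1 x
    rw [LinearMap.comp_apply, LinearMap.restrictScalars_apply, J_lof, psiTot_lof, J_lof]
    -- The sign is a scalar of $A$ on one side and of $A'$ on the other. Splitting by parity turns
    -- both into the identity or negation, which every additive map respects.
    rcases n.even_or_odd with e | e
    · simp only [e.neg_one_pow, one_smul, psiTot_lof]
    · simp only [e.neg_one_pow, tot_neg_smul, one_smul, map_neg, LinearMap.neg_apply, psiTot_lof]

/-! ### Multiplicativity on chains. -/

/-- Double induction along the shuffle recursion: in each of its two terms one of the words has lost
its first letter. The outer hypothesis is kept for all `b`, since the first term pairs `a` with the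
full word `v :: b`. -/
lemma psiTot_shT_word (h : SemiMeasuring ψ Ψ) : ∀ a b : List V,
    psiTot h (shT A V (word a) (word b)) =
      conv (shTot k A' V') (psiTot h (word a)) (psiTot h (word b)) := by
  intro a
  induction a with
  | nil =>
    intro b
    rw [shT_nil_left, psiTot_word_nil, conv_counit_left]
    exact LinearMap.ext fun x => (shT_nil_left _).symm
  | cons u a iha =>
    intro b
    induction b with
    | nil =>
      -- `conv_counit_left` wants the counit in the first place, so the two factors are exchanged.
      rw [shT_nil_right, psiTot_word_nil, conv_comm (b' := (shTot k A' V').flip) (fun _ _ => rfl),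
        conv_counit_left]
      exact LinearMap.ext fun x => (shT_nil_right _).symm
    | cons v b ihb =>
      -- The second term of the recursion involves the signed word, which is plus or minus the word
      -- covered by `ihb`.
      have hJ : psiTot h (shT A V (J A V (word (u :: a))) (word b)) =
          conv (shTot k A' V') (psiTot h (J A V (word (u :: a)))) (psiTot h (word b)) := by
        rw [J_word]
        rcases (u :: a).length.even_or_odd with e | e
        · simp only [e.neg_one_pow, one_smul, ihb]
        · simp only [e.neg_one_pow, tot_neg_smul, one_smul, map_neg, LinearMap.neg_apply, ihb]
          rw [← neg_one_smul k (psiTot h (word (u :: a))), conv_smul_left]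
          exact (neg_one_smul k _).symm
      rw [shT_cons_word, map_add, psiTot_L, psiTot_L, iha, hJ, psiTot_J, word_cons, word_cons,
        psiTot_L, psiTot_L]
      -- What remains is the shuffle recursion of the target, convolved over $C$.
      exact (conv_shuffle_rule (shTot k A' V') (consTot k A' V') ((J A' V').restrictScalars k)
        (fun u v x y => shT_L_L u v x y) _ _ _ _).symm

/-- `tot_ext` compares maps linear over $A$ only, so for the induced map the scalar in front of a
word has to be treated as part of the generator. -/
lemma tot_smul_induction {P : Tot A V → Prop} (h0 : P 0) (h : ∀ (a : A) l, P (a • word l))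
    (ha : ∀ x y, P x → P y → P (x + y)) (x : Tot A V) : P x := by
  induction x using tot_induction with
  | h0 => exact h0
  | ha x y hx hy => exact ha x y hx hy
  | h n z =>
    induction z using PiTensorProduct.induction_on with
    | smul_tprod r u => rw [map_smul, lof_tprod]; exact h r _
    | add y z hy hz => rw [map_add]; exact ha _ _ hy hz

/-- The induced map is multiplicative for shuffle products. -/
lemma psiTot_shT (h : SemiMeasuring ψ Ψ) (x y : Tot A V) :
    psiTot h (shT A V x y) = conv (shTot k A' V') (psiTot h x) (psiTot h y) := by
  induction x using tot_smul_induction with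
  | h0 => rw [map_zero, LinearMap.zero_apply, map_zero, conv_zero_left]
  | ha x y hx hy => rw [map_add, LinearMap.add_apply, map_add, hx, hy, map_add, conv_add_left]
  | h a l =>
    -- Scalars are removed from one factor at a time: the left factor stays a bare word while `y`
    -- becomes arbitrary.
    have hl : psiTot h (shT A V (word l) y) =
        conv (shTot k A' V') (psiTot h (word l)) (psiTot h y) := by
      induction y using tot_smul_induction with
      | h0 => rw [map_zero, map_zero, conv_zero_right]
      | ha x y hx hy => rw [map_add, map_add, hx, hy, map_add, conv_add_right]
      | h c m =>
        rw [map_smul, psiTot_smul, psiTot_smul, psiTot_shT_word,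
          -- The leg acting on the scalar `c` must pass the leg acting on `word l`. Moving the
          -- latter to the last place on both sides leaves a plain reassociation.
          conv_comm (b' := (shTot k A' V').flip) (fun _ _ => rfl) (psiTot h (word l)),
          conv_comm (b' := (shTot k A' V').flip) (fun _ _ => rfl) (psiTot h (word l))]
        exact (conv_assoc (fun a y x => map_smul (shT A' V' x) a y) _ _ _).symm
    rw [map_smul, LinearMap.smul_apply, psiTot_smul, psiTot_smul, hl]
    exact (conv_assoc (fun a x y => LinearMap.map_smul₂ (shT A' V') a x y) _ _ _).symm

/-! ### Passage to homology. -/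

/-- The homogeneous form of `psiTot_shT`, recovered because the inclusion of a summand is injective.
A finite sum over a representation of $\Delta x$ can be applied directly to representing cycles. -/
lemma psiMap_shuffleMap (h : SemiMeasuring ψ Ψ) {p q : ℕ} (y : TPow A V p) (z : TPow A V q)
    (x : C) {ι : Type*} (r : Coalgebra.Repr k x ι) :
    psiMap h (p + q) x (shuffleMap p q y z) =
      ∑ i ∈ r.index, shuffleMap p q (psiMap h p (r.left i) y) (psiMap h q (r.right i) z) := by
  refine lof_inj ?_
  have e := LinearMap.congr_fun (psiTot_shT h (DirectSum.lof A ℕ (TPow A V) p y)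
    (DirectSum.lof A ℕ (TPow A V) q z)) x
  rw [shT_lof, psiTot_lof, conv_apply_repr _ _ _ x r] at e
  rw [map_sum]
  refine e.trans (Finset.sum_congr rfl fun i _ => ?_)
  rw [psiTot_lof, psiTot_lof]
  exact shT_lof _ _

lemma psiMap_one (h : SemiMeasuring ψ Ψ) (α β : V →ₗ[A] A) (α' β' : V' →ₗ[A'] A') (x : C) :
    psiMap h 0 x (cyclesOne k α β).1 =
      (Coalgebra.counit x : k) • (cyclesOne k α' β').1 :=
  LinearMap.congr_fun (psiHom_tprod h 0 _) x

/-- The maps induced on homology form a measuring of algebras. -/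
lemma isMeasuring_psiTotal (h : SemiMeasuring ψ Ψ) {α β : V →ₗ[A] A} {α' β' : V' →ₗ[A'] A'}
    (hα : ∀ x v, ψ x (α v) = α' (Ψ x v)) (hβ : ∀ x v, ψ x (β v) = β' (Ψ x v)) :
    IsMeasuring k (psiTotal h hα hβ : C →ₗ[k] (⨁ n, BarHH k α β n) →ₗ[k] ⨁ n, BarHH k α' β' n) := by
  -- The induced map preserves degree, so both axioms reduce to homogeneous classes.
  have hof : ∀ (x : C) (n : ℕ) (z : BarHH k α β n),
      psiTotal h hα hβ x (DirectSum.of (BarHH k α β) n z) =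
        DirectSum.of (BarHH k α' β') n (psiHH h hα hβ n x z) := fun x n z =>
    LinearMap.congr_fun (DirectSum.toModule_lof k n z) x
  constructor
  · intro x a b
    induction a using DirectSum.induction_on with
    | zero => rw [zero_mul, map_zero, map_zero, conv_zero_left, LinearMap.zero_apply]
    | add a a' ha ha' =>
      rw [add_mul, map_add, ha, ha', map_add, conv_add_left, LinearMap.add_apply]
    | of p y =>
      induction b using DirectSum.induction_on with
      | zero => rw [mul_zero, map_zero, map_zero, conv_zero_right, LinearMap.zero_apply]
      | add b b' hb hb' =>
        rw [mul_add, map_add, hb, hb', map_add, conv_add_right, LinearMap.add_apply]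
      | of q z =>
        obtain ⟨y, rfl⟩ := BarHH.mk_surjective p y
        obtain ⟨z, rfl⟩ := BarHH.mk_surjective q z
        let r := Coalgebra.Repr.arbitrary k x
        rw [conv_apply_repr _ _ _ x r, DirectSum.of_mul_of, hof]
        -- Both sides are classes of explicit cycles, and these cycles are already equal as chains;
        -- no boundary is needed.
        have e : psiHH h hα hβ (p + q) x (BarHH.mul p q (BarHH.mk p y) (BarHH.mk q z)) =
            ∑ i ∈ r.index, BarHH.mul p q (psiHH h hα hβ p (r.left i) (BarHH.mk p y))
              (psiHH h hα hβ q (r.right i) (BarHH.mk q z)) := by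
          simp only [BarHH.mul_mk, psiHH_mk, ← map_sum]
          refine congrArg _ (Subtype.ext ?_)
          rw [AddSubmonoidClass.coe_finsetSum]
          exact psiMap_shuffleMap h y.1 z.1 x r
        -- The graded product produced by `DirectSum.of_mul_of` is `BarHH.mul` only up to unfolding,
        -- so `e` is applied as a term. The closing `rfl` has the same cause.
        refine (congrArg _ e).trans ?_
        rw [map_sum]
        refine Finset.sum_congr rfl fun i _ => ?_
        rw [LinearMap.mul_apply', LinearMap.flip_apply, LinearMap.flip_apply, hof, hof,
          DirectSum.of_mul_of]
        rfl
  · intro x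
    -- The unit of the direct sum is by definition the class of the empty tensor in degree $0$.
    refine (hof x 0 (BarHH.mk 0 (cyclesOne k α β))).trans ?_
    rw [psiHH_mk]
    have e : (⟨psiMap h 0 x (cyclesOne k α β).1, psiMap_mem_cycles h hα hβ 0 x
        (cyclesOne k α β).2⟩ : cycles k α' β' 0) =
        (Coalgebra.counit x : k) • cyclesOne k α' β' := Subtype.ext (psiMap_one h α β α' β' x)
    rw [e, map_smul]
    exact map_smul (DirectSum.lof k ℕ (BarHH k α' β') 0) _ _

end TotInduced

end HopfMeasuring

/-- The general result for $U$ as an $A$-algebra through $t$, with the functionals $\epsilon_R$ and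
$\epsilon_R\circ S$. Compatibility with the target gives the twisted linearity in `h.semi`;
compatibility with counit and antipode gives that with the two functionals. -/
theorem proposition4p1 {k A U A' U' C : Type*} [Field k]
    [CommRing A] [Algebra k A] [CommRing U] [Algebra k U]
    [CommRing A'] [Algebra k A'] [CommRing U'] [Algebra k U']
    [AddCommGroup C] [Module k C] [Coalgebra k C] [Coalgebra.IsCocomm k C]
    (H : HopfMeasuring.CommHopfAlgebroid k A U) (H' : HopfMeasuring.CommHopfAlgebroid k A' U')
    (Ψ : C →ₗ[k] U →ₗ[k] U') (ψ : C →ₗ[k] A →ₗ[k] A')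
    (h : HopfMeasuring.IsHopfMeasuring H H' Ψ ψ) :
    HopfMeasuring.IsMeasuring k (HopfMeasuring.hochMap h : C →ₗ[k] H.HH →ₗ[k] H'.HH) :=
  HopfMeasuring.isMeasuring_psiTotal h.semi h.map_εR h.map_εRS
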